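/- Graphs are finite and undirected; loops and parallel edges are allowed. Let $G$ be a graph with vertex set $V(G)=A\cup B$ and put $\overline{A}=B\setminus A$. Let $G^{A,B}$ be the biconed graph obtained from $G$ by adding two new vertices $0$ and $\overline{0}$, the edge $0\overline{0}$, an edge $0a$ for every $a\in A$, and an edge $\overline{0}b$ for every $b\in B$. Let $G^{A,B}_{\mathrm{red}}$ be the graph obtained from $G^{A,B}$ by removing the edge $0\overline{0}$, all edges $0a$ added for $a\in A$, all edges $\overline{0}b$ added for $b\in\overline{A}$, and the vertex $0$. Let $d$ be the rank of the graphic matroid of $G^{A,B}$ (the maximal size of an acyclic set of edges), and for $0\le i\le d$ let $f_{i-1}$ be the number of acyclic sets of $i$ edges of $G^{A,B}$. The $h$-vector $(h_0,\dots,h_d)$ of $G^{A,B}$ is defined by $$\sum_{i=0}^d f_{i-1}(t-1)^{d-i}=\sum_{k=0}^d h_k t^{d-k}.$$ Let $(F,\mathbf{m})$ be a finite multiset of edges of $G^{A,B}_{\mathrm{red}}$, with underlying set $F$ and multiplicities $\mathbf{m}(e)\ge 1$ for $e\in F$. An edge $e\in F$ has $\mathbf{m}(e)-1$ edge roots. Regard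 $F$ as a spanning subgraph of $G^{A,B}_{\mathrm{red}}$. A component of $F$ is $n$-edge-rooted if $n$ is the total number of edge roots of its edges, plus $1$ if it contains $\overline{0}$. An edge is bridging if it connects a vertex in $A$ to a vertex in $\overline{A}\cup\{\overline{0}\}$. The multiset $(F,\mathbf{m})$ is a partially $2$-edge-rooted forest of $G^{A,B}_{\mathrm{red}}$ if $F$ is acyclic, at most one component is $2$-edge-rooted, every other component is $0$- or $1$-edge-rooted, and, if there is a $2$-edge-rooted component, the shortest path in it that contains all of its rooted edges (and also the vertex $\overline{0}$, if $\overline{0}$ lies in the component) has an odd number of bridging edges. Its degree is $\sum_{e\in F}\mathbf{m}(e)$. Then for every $i\in\{0,\dots,d\}$, the number $h_i$ equals the number of partially $2$-edge-rooted forests of $G^{A,B}_{\mathrm{red}}$ of degree $i$. -/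

import Mathlib

open scoped Graph

namespace BiconedGraph

universe u v

/-! ### Walks, paths, cycles and forests in multigraphs -/

section Walks

variable {α : Type u} {β : Type v}

/-- Walks in a multigraph. -/
inductive Walk (G : Graph α β) : α → α → Type (max u v)
  | nil (x : α) (hx : x ∈ V(G)) : Walk G x x
  | cons {x y z : α} (e : β) (h : G.IsLink e x y) (p : Walk G y z) : Walk G x z

/-- The list of edges traversed by a walk. -/
def Walk.edges {G : Graph α β} : {x y : α} → Walk G x y → List β
  | _, _, .nil _ _ => []
  | _, _, .cons e _ p => e :: p.edges

/-- The list of vertices visited by a walk, including both ends. -/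
def Walk.support {G : Graph α β} : {x y : α} → Walk G x y → List α
  | x, _, .nil _ _ => [x]
  | x, _, .cons _ _ p => x :: p.support

/-- The number of edges traversed by a walk. -/
def Walk.length {G : Graph α β} {x y : α} (p : Walk G x y) : ℕ := p.edges.length

/-- A path is a walk without repeated vertices. -/
def Walk.IsPath {G : Graph α β} {x y : α} (p : Walk G x y) : Prop := p.support.Nodup

/-- A cycle is a closed walk with at least one edge that repeats no edge, and no vertex other than
its base point at the two ends. Loops and pairs of parallel edges give cycles of lengths 1 and 2. -/
def Walk.IsCycle {G : Graph α β} {x : α} (p : Walk G x x) : Prop :=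
  p.edges ≠ [] ∧ p.edges.Nodup ∧ p.support.tail.Nodup

/-- A forest is a multigraph without cycles. -/
def IsForest (G : Graph α β) : Prop := ∀ (x : α) (p : Walk G x x), ¬ p.IsCycle

/-- `C` is the vertex set of a connected component of `G`. -/
def IsComponent (G : Graph α β) (C : Set α) : Prop :=
  ∃ x ∈ V(G), C = {y | Nonempty (Walk G x y)}

/-- The independence complex of the graphic matroid of `G`: its independent sets are the acyclic
sets of edges of `G`. -/
def graphicComplex (G : Graph α β) : Set (Finset β) :=
  {I | (I : Set β) ⊆ E(G) ∧ IsForest (G.restrict (I : Set β))}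

end Walks

/-! ### The `h`-vector of a (finite) simplicial complex -/

section HVector

variable {β : Type v}

/-- The number of faces of cardinality `i`, that is, `f_{i-1}`. -/
noncomputable def fVec (Δ : Set (Finset β)) (i : ℕ) : ℕ := {s | s ∈ Δ ∧ s.card = i}.ncard

/-- The largest cardinality `d` of a face; for the independence complex of a matroid, the rank. -/
noncomputable def faceRank (Δ : Set (Finset β)) : ℕ := sSup (Finset.card '' Δ)

open Polynomial in
/-- The polynomial `∑_{i=0}^d f_{i-1} (t-1)^{d-i}`. -/
noncomputable def hPoly (Δ : Set (Finset β)) : Polynomial ℤ :=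
  ∑ i ∈ Finset.range (faceRank Δ + 1),
    (fVec Δ i : Polynomial ℤ) * (X - 1) ^ (faceRank Δ - i)

/-- The entries `h_0, …, h_d` of the `h`-vector, determined by
`∑_{i=0}^d f_{i-1} (t-1)^{d-i} = ∑_{k=0}^d h_k t^{d-k}`. -/
noncomputable def hVec (Δ : Set (Finset β)) (k : Fin (faceRank Δ + 1)) : ℤ :=
  (hPoly Δ).coeff (faceRank Δ - (k : ℕ))

end HVector

/-! ### Biconed graphs -/

/-- The vertices of a biconing: the two coning vertices `0` and `0̄` and the old vertices. -/
inductive Vert (α : Type u) : Type u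
  | zero : Vert α
  | zeroBar : Vert α
  | old (x : α) : Vert α

/-- The edges of a biconing: `00̄`, the edges `0a`, the edges `0̄b`, and the old edges. -/
inductive Edge (α : Type u) (β : Type v) : Type (max u v)
  | cone : Edge α β
  | zeroTo (a : α) : Edge α β
  | zeroBarTo (b : α) : Edge α β
  | old (e : β) : Edge α β

section Biconing

variable {α : Type u} {β : Type v}

/-- The incidence relation of the biconing. -/
def biconingLink (G : Graph α β) (A B : Set α) : Edge α β → Vert α → Vert α → Prop
  | .cone, x, y => s(x, y) = s(Vert.zero, Vert.zeroBar)
  | .zeroTo a, x, y => a ∈ A ∧ s(x, y) = s(Vert.zero, Vert.old a)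
  | .zeroBarTo b, x, y => b ∈ B ∧ s(x, y) = s(Vert.zeroBar, Vert.old b)
  | .old e, x, y => ∃ u v, G.IsLink e u v ∧ x = Vert.old u ∧ y = Vert.old v

/-- The biconing `G^{A,B}` of a multigraph `G` with `V(G) = A ∪ B`. -/
def biconing (G : Graph α β) (A B : Set α) (hAB : V(G) = A ∪ B) :
    Graph (Vert α) (Edge α β) where
  vertexSet := {Vert.zero, Vert.zeroBar} ∪ Vert.old '' V(G)
  IsLink := biconingLink G A B
  isLink_symm := by
    intro e _
    refine ⟨fun x y h => ?_⟩
    cases e with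
    | cone => exact Sym2.eq_swap.trans h
    | zeroTo a => exact ⟨h.1, Sym2.eq_swap.trans h.2⟩
    | zeroBarTo b => exact ⟨h.1, Sym2.eq_swap.trans h.2⟩
    | old e =>
      obtain ⟨u, v, huv, hx, hy⟩ := h
      exact ⟨v, u, huv.symm, hy, hx⟩
  eq_or_eq_of_isLink_of_isLink := by
    have key : ∀ {x y v w p q : Vert α}, s(x, y) = s(p, q) → s(v, w) = s(p, q) →
        x = v ∨ x = w := by
      intro x y v w p q h h'
      have hx : x ∈ s(v, w) := h' ▸ h ▸ Sym2.mem_mk_left x y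
      simpa using hx
    intro e x y v w h h'
    cases e with
    | cone => exact key h h'
    | zeroTo a => exact key h.2 h'.2
    | zeroBarTo b => exact key h.2 h'.2
    | old e =>
      obtain ⟨u₁, v₁, h₁, rfl, rfl⟩ := h
      obtain ⟨u₂, v₂, h₂, rfl, rfl⟩ := h'
      rcases h₁.left_eq_or_eq h₂ with h | h
      · exact Or.inl (congrArg _ h)
      · exact Or.inr (congrArg _ h)
  left_mem_of_isLink := by
    intro e x y h
    cases e with
    | cone =>
      have hx : x ∈ s(Vert.zero, Vert.zeroBar) := h ▸ Sym2.mem_mk_left x y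
      exact Or.inl (by simpa using hx)
    | zeroTo a =>
      have hx : x ∈ s(Vert.zero, Vert.old a) := h.2 ▸ Sym2.mem_mk_left x y
      rcases Sym2.mem_iff.1 hx with rfl | rfl
      · exact Or.inl (Or.inl rfl)
      · exact Or.inr ⟨a, hAB ▸ Or.inl h.1, rfl⟩
    | zeroBarTo b =>
      have hx : x ∈ s(Vert.zeroBar, Vert.old b) := h.2 ▸ Sym2.mem_mk_left x y
      rcases Sym2.mem_iff.1 hx with rfl | rfl
      · exact Or.inl (Or.inr rfl)
      · exact Or.inr ⟨b, hAB ▸ Or.inr h.1, rfl⟩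
    | old e =>
      obtain ⟨u, v, huv, rfl, rfl⟩ := h
      exact Or.inr ⟨u, huv.left_mem, rfl⟩

/-- The edges of the spanning tree `T₀`: the edge `00̄`, the edges `0a` for `a ∈ A`, and the edges
`0̄b` for `b ∈ B \ A`. -/
def baseTree (A B : Set α) : Set (Edge α β) :=
  {Edge.cone} ∪ Edge.zeroTo '' A ∪ Edge.zeroBarTo '' (B \ A)

/-- The reduced graph: `G^{A,B}` with the edges of `T₀` and the vertex `0` removed. -/
def reduced (G : Graph α β) (A B : Set α) (hAB : V(G) = A ∪ B) : Graph (Vert α) (Edge α β) :=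
  ((biconing G A B hAB).deleteEdges (baseTree A B)).deleteVerts {Vert.zero}

/-- An edge of the graph `H` is bridging if it connects a vertex in `A` to a vertex in
`(B \ A) ∪ {0̄}`. -/
def IsBridging (H : Graph (Vert α) (Edge α β)) (A B : Set α) (e : Edge α β) : Prop :=
  ∃ x ∈ Vert.old '' A, ∃ y ∈ Vert.old '' (B \ A) ∪ {Vert.zeroBar}, H.IsLink e x y

/-- The graph on all vertices of the reduced graph whose edges are the edges occurring in the
multiset `m`. -/
def supportGraph (G : Graph α β) (A B : Set α) (hAB : V(G) = A ∪ B) (m : Multiset (Edge α β)) :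
    Graph (Vert α) (Edge α β) :=
  (reduced G A B hAB).restrict {e | e ∈ m}

open Classical in
/-- The multiset of edge roots: an edge of multiplicity `k ≥ 1` in `m` has `k - 1` roots. -/
noncomputable def edgeRoots (m : Multiset (Edge α β)) : Multiset (Edge α β) := m - m.dedup

open Classical in
/-- The edge roots in the component `C` of the graph `H`. -/
noncomputable def rootsIn (H : Graph (Vert α) (Edge α β)) (m : Multiset (Edge α β))
    (C : Set (Vert α)) : Multiset (Edge α β) :=
  (edgeRoots m).filter (fun e => ∃ x ∈ C, H.Inc e x)

open Classical in
/-- The number `n` such that the component `C` is `n`-edge-rooted: the number of edge roots in it,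
plus `1` if it contains `0̄`. -/
noncomputable def rootNumber (H : Graph (Vert α) (Edge α β)) (m : Multiset (Edge α β))
    (C : Set (Vert α)) : ℕ :=
  (rootsIn H m C).card + if Vert.zeroBar ∈ C then 1 else 0

/-- The walk `p` is a path containing all edge roots of the component `C`, and containing `0̄`
if `C` does. -/
def IsRootPath (H : Graph (Vert α) (Edge α β)) (m : Multiset (Edge α β)) (C : Set (Vert α))
    {x y : Vert α} (p : Walk H x y) : Prop :=
  p.IsPath ∧ (∀ e ∈ rootsIn H m C, e ∈ p.edges) ∧ (Vert.zeroBar ∈ C → Vert.zeroBar ∈ p.support)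

/-- A shortest path among those containing all edge roots of `C` (and `0̄` if `C` does). -/
def IsShortestRootPath (H : Graph (Vert α) (Edge α β)) (m : Multiset (Edge α β))
    (C : Set (Vert α)) {x y : Vert α} (p : Walk H x y) : Prop :=
  IsRootPath H m C p ∧ ∀ (x' y' : Vert α) (q : Walk H x' y'), IsRootPath H m C q →
    p.length ≤ q.length

open Classical in
/-- The number of bridging edges traversed by a walk. -/
noncomputable def bridgingCount {H : Graph (Vert α) (Edge α β)} (A B : Set α) {x y : Vert α}
    (p : Walk H x y) : ℕ :=
  (p.edges.filter (fun e => IsBridging H A B e)).length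

/-- Partially 2-edge-rooted forests of the reduced graph of `G^{A,B}`: multisets of edges whose
underlying set is (the edge set of) a spanning forest with at most one 2-edge-rooted component, all
other components being 0- or 1-edge-rooted, such that in a 2-edge-rooted component the shortest
path containing the edge roots (and `0̄` if it lies in the component) has an odd number of
bridging edges. -/
structure IsTwoEdgeRootedForest (G : Graph α β) (A B : Set α) (hAB : V(G) = A ∪ B)
    (m : Multiset (Edge α β)) : Prop where
  subset : ∀ e ∈ m, e ∈ E(reduced G A B hAB)
  forest : IsForest (supportGraph G A B hAB m)
  atMostOne : ∀ C C' : Set (Vert α), IsComponent (supportGraph G A B hAB m) C →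
    IsComponent (supportGraph G A B hAB m) C' →
    rootNumber (supportGraph G A B hAB m) m C = 2 →
    rootNumber (supportGraph G A B hAB m) m C' = 2 → C = C'
  others : ∀ C : Set (Vert α), IsComponent (supportGraph G A B hAB m) C →
    rootNumber (supportGraph G A B hAB m) m C ≠ 2 →
    rootNumber (supportGraph G A B hAB m) m C = 0 ∨ rootNumber (supportGraph G A B hAB m) m C = 1
  parity : ∀ C : Set (Vert α), IsComponent (supportGraph G A B hAB m) C →
    rootNumber (supportGraph G A B hAB m) m C = 2 →
    ∃ (x y : Vert α) (p : Walk (supportGraph G A B hAB m) x y),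
      IsShortestRootPath (supportGraph G A B hAB m) m C p ∧ Odd (bridgingCount A B p)

end Biconing

end BiconedGraph

/-! Both sides are sorted by a forest `F` of the reduced graph: for a face, its edges outside the
base tree `T₀`; for a rooted forest, its underlying set. It suffices to match generating functions
for each fixed `F`.

A face over `F` is given by a set `S` of old vertices, whose tree edges it contains, and by whether
it contains `00̄`. Call the elements of `S` and `0̄` marked. Without `00̄`, acyclicity means that
every component of `F` has at most one marked vertex, except that at most one component may have
two, of different colours (`isForest_biconing_iff`); the colours are `A` and its complement,
according to whether an old vertex hangs on `0` or on `0̄`. With `00̄`, no exception is allowed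
(`isForest_biconing_insert_cone_iff`).

Rootings of `F` obey the same pattern, with edge roots in place of elements of `S`. The number of
bridging edges of a path is odd exactly when its ends have different colours
(`odd_bridgingCount_iff`), so the parity condition is again about two vertices of different colours.

The rule "at most one exceptional component" is encoded in dual numbers: a component has weight `y`
if it is empty, `1` if it has one mark, and `ε` if it has an admissible pair. As `ε² = 0`, the
product over components discards everything else, and the sum over all markings factors over
components. With `y = x - 1` for vertex markings and `y = x` for edge rootings, the local sums agree
(`sum_stateWeight_vertices_eq_edges`). A tree `C` without `0̄` gives `(x - 1) + |C|` and `x + (|C| -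
1)`, plus `|C ∩ A| |C \ A| ε` on both sides: a pair of vertices of different colours corresponds to
the first and last edge of the path between them. The tree containing `0̄` gives `1 + |C ∩ A| ε` on
both sides.

If the common product is `p + q ε`, the faces without `00̄` contribute `(x - 1) p + q`, those with
`00̄` contribute `p`, and the rootings contribute `x p + q`. These agree
(`sum_faces_eq_sum_rootings`), and summation over `F` gives `hPoly_biconing`. -/

namespace BiconedGraph

universe u v

/-! ### Walks, reachability, and forests under insertion of an edge -/

section WalkBasics

variable {α : Type u} {β : Type v} {G H : Graph α β}

namespace Walk

/-- Concatenation of walks. -/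
def append {G : Graph α β} : {x y z : α} → Walk G x y → Walk G y z → Walk G x z
  | _, _, _, .nil _ _, q => q
  | _, _, _, .cons e h p, q => .cons e h (p.append q)

/-- The walk with a single edge. -/
def single {x y : α} (e : β) (h : G.IsLink e x y) : Walk G x y := .cons e h (.nil y h.right_mem)

/-- The reverse of a walk. -/
def reverse {G : Graph α β} : {x y : α} → Walk G x y → Walk G y x
  | _, _, .nil x hx => .nil x hx
  | _, _, .cons e h p => p.reverse.append (single e h.symm)

lemma left_mem {x y : α} (p : Walk G x y) : x ∈ V(G) := by
  cases p with
  | nil _ hx => exact hx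
  | cons e h p => exact h.left_mem

lemma right_mem {x y : α} (p : Walk G x y) : y ∈ V(G) := by
  induction p with
  | nil _ hx => exact hx
  | cons e h p ih => exact ih

@[simp] lemma edges_nil (x : α) (hx : x ∈ V(G)) : (Walk.nil x hx).edges = [] := by simp [edges]

@[simp] lemma edges_cons {x y z : α} (e : β) (h : G.IsLink e x y) (p : Walk G y z) :
    (Walk.cons e h p).edges = e :: p.edges := by simp [edges]

@[simp] lemma support_nil (x : α) (hx : x ∈ V(G)) : (Walk.nil x hx).support = [x] := by
  simp [support]

@[simp] lemma support_cons {x y z : α} (e : β) (h : G.IsLink e x y) (p : Walk G y z) :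
    (Walk.cons e h p).support = x :: p.support := by simp [support]

@[simp] lemma edges_single {x y : α} (e : β) (h : G.IsLink e x y) : (single e h).edges = [e] := by
  simp [single]

@[simp] lemma support_single {x y : α} (e : β) (h : G.IsLink e x y) :
    (single e h).support = [x, y] := by simp [single]

@[simp] lemma edges_append {x y z : α} (p : Walk G x y) (q : Walk G y z) :
    (p.append q).edges = p.edges ++ q.edges := by
  induction p with
  | nil => simp [append]
  | cons e h p ih => simp [append, ih]

lemma support_eq_cons {x y : α} (p : Walk G x y) : p.support = x :: p.support.tail := by
  cases p <;> simp

lemma support_append {x y z : α} (p : Walk G x y) (q : Walk G y z) :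
    (p.append q).support = p.support ++ q.support.tail := by
  induction p with
  | nil => simpa [append] using q.support_eq_cons
  | cons e h p ih => simp [append, ih]

@[simp] lemma edges_reverse {x y : α} (p : Walk G x y) : p.reverse.edges = p.edges.reverse := by
  induction p with
  | nil => simp [reverse]
  | cons e h p ih => simp [reverse, ih]

@[simp] lemma support_reverse {x y : α} (p : Walk G x y) :
    p.reverse.support = p.support.reverse := by
  induction p with
  | nil => simp [reverse]
  | cons e h p ih => simp [reverse, ih, support_append]

@[simp] lemma length_reverse {x y : α} (p : Walk G x y) : p.reverse.length = p.length := by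
  simp [length]

@[simp] lemma length_append {x y z : α} (p : Walk G x y) (q : Walk G y z) :
    (p.append q).length = p.length + q.length := by
  simp [length]

lemma IsPath.reverse {x y : α} {p : Walk G x y} (hp : p.IsPath) : p.reverse.IsPath := by
  simpa [IsPath] using hp

lemma left_mem_support {x y : α} (p : Walk G x y) : x ∈ p.support := by
  rw [support_eq_cons]; simp

lemma right_mem_support {x y : α} (p : Walk G x y) : y ∈ p.support := by
  have := p.reverse.left_mem_support
  simpa using this

lemma mem_support_of_mem_edges {x y u v : α} {e : β} (p : Walk G x y) (he : e ∈ p.edges)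
    (h : G.IsLink e u v) : u ∈ p.support := by
  induction p with
  | nil => simp at he
  | cons f hf p ih =>
    simp at he
    rcases he with rfl | he
    · rcases h.left_eq_or_eq hf with rfl | rfl
      · simp
      · simp [p.left_mem_support]
    · simp [ih he]

lemma exists_isLink_of_mem_edges {x y : α} {e : β} (p : Walk G x y) (he : e ∈ p.edges) :
    ∃ u v, G.IsLink e u v := by
  induction p with
  | nil => simp at he
  | cons f hf p ih =>
    simp at he
    rcases he with rfl | he
    · exact ⟨_, _, hf⟩
    · exact ih he

lemma exists_append_of_mem_support {x y v : α} (p : Walk G x y) (hv : v ∈ p.support) :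
    ∃ (q : Walk G x v) (r : Walk G v y), p = q.append r := by
  induction p with
  | nil x hx =>
    simp at hv; subst hv
    exact ⟨.nil _ hx, .nil _ hx, by simp [append]⟩
  | cons e h p ih =>
    rw [support_cons, List.mem_cons] at hv
    rcases hv with rfl | hv
    · exact ⟨.nil _ h.left_mem, .cons e h p, by simp [append]⟩
    · obtain ⟨q, r, rfl⟩ := ih hv
      exact ⟨.cons e h q, r, by simp [append]⟩

lemma IsPath.of_append_left {x y z : α} {p : Walk G x y} {q : Walk G y z}
    (h : (p.append q).IsPath) : p.IsPath := by
  rw [IsPath, support_append] at h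
  exact h.of_append_left

lemma IsPath.of_append_right {x y z : α} {p : Walk G x y} {q : Walk G y z}
    (h : (p.append q).IsPath) : q.IsPath := by
  have := h.reverse
  have h2 : (q.reverse.append p.reverse).IsPath := by
    rw [IsPath] at this ⊢
    rw [support_append] at *
    have e : (q.reverse.support ++ p.reverse.support.tail) = (p.append q).support.reverse := by
      rw [support_append]
      have h1 := p.reverse.support_eq_cons
      have h2 := q.support_eq_cons
      rw [support_reverse] at *
      rw [List.reverse_append]
      conv_rhs => rw [h1]
      conv_lhs => rw [h2]
      simp
    rw [e]; simpa using this
  simpa [IsPath] using h2.of_append_left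

lemma exists_isPath {x y : α} (p : Walk G x y) :
    ∃ q : Walk G x y, q.IsPath ∧ q.edges ⊆ p.edges := by
  induction p with
  | nil x hx => exact ⟨.nil x hx, by simp [IsPath], by simp⟩
  | @cons x y z e h p ih =>
    obtain ⟨q, hq, hqe⟩ := ih
    by_cases hx : x ∈ q.support
    · obtain ⟨q1, q2, rfl⟩ := q.exists_append_of_mem_support hx
      refine ⟨q2, hq.of_append_right, ?_⟩
      intro f hf
      simp only [edges_append] at hqe
      simp [hqe (List.mem_append_right _ hf)]
    · refine ⟨.cons e h q, ?_, ?_⟩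
      · simpa [IsPath, hx] using hq
      · simp only [edges_cons]
        exact List.cons_subset_cons _ hqe

lemma IsPath.nodup_edges {x y : α} {p : Walk G x y} (hp : p.IsPath) : p.edges.Nodup := by
  induction p with
  | nil => simp
  | cons e h p ih =>
    simp only [IsPath, support_cons, List.nodup_cons] at hp
    simp only [edges_cons, List.nodup_cons]
    exact ⟨fun he => hp.1 (p.mem_support_of_mem_edges he h), ih hp.2⟩

lemma exists_transfer {x y : α} (p : Walk G x y) (hx : x ∈ V(H))
    (h : ∀ e ∈ p.edges, ∀ u v, G.IsLink e u v → H.IsLink e u v) :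
    ∃ q : Walk H x y, q.edges = p.edges ∧ q.support = p.support := by
  induction p with
  | nil x _ => exact ⟨.nil x hx, by simp⟩
  | cons e he p ih =>
    have hl := h e (by simp) _ _ he
    obtain ⟨q, hq1, hq2⟩ := ih hl.right_mem (fun f hf => h f (by simp [hf]))
    exact ⟨.cons e hl q, by simp [hq1], by simp [hq2]⟩

end Walk

/-- Two vertices are joined by a walk. -/
def Reach (G : Graph α β) (x y : α) : Prop := Nonempty (Walk G x y)

lemma Reach.refl {x : α} (hx : x ∈ V(G)) : Reach G x x := ⟨.nil x hx⟩

lemma Reach.symm {x y : α} (h : Reach G x y) : Reach G y x := h.map Walk.reverse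

lemma Reach.trans {x y z : α} (h : Reach G x y) (h' : Reach G y z) : Reach G x z :=
  ⟨h.some.append h'.some⟩

lemma Reach.of_isLink {x y : α} {e : β} (h : G.IsLink e x y) : Reach G x y := ⟨.single e h⟩

lemma Reach.left_mem {x y : α} (h : Reach G x y) : x ∈ V(G) := h.some.left_mem

lemma Reach.right_mem {x y : α} (h : Reach G x y) : y ∈ V(G) := h.some.right_mem

lemma Reach.exists_isPath {x y : α} (h : Reach G x y) : ∃ p : Walk G x y, p.IsPath := by
  obtain ⟨q, hq, -⟩ := h.some.exists_isPath
  exact ⟨q, hq⟩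

lemma Reach.mono (hGH : G ≤ H) {x y : α} (h : Reach G x y) : Reach H x y := by
  obtain ⟨q, -⟩ := h.some.exists_transfer (hGH.vertexSet_mono h.left_mem)
    (fun e _ u v huv => hGH.isLink_mono huv)
  exact ⟨q⟩

/-- A set of vertices closed under adjacency is closed under reachability. -/
lemma Reach.mem_of_closed {x y : α} (h : Reach G x y) {K : Set α}
    (hK : ∀ e u v, G.IsLink e u v → u ∈ K → v ∈ K) (hx : x ∈ K) : y ∈ K := by
  obtain ⟨p⟩ := h
  induction p with
  | nil => exact hx
  | cons e h p ih => exact ih (hK _ _ _ h hx)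

/-- An edge lies on a cycle exactly when its ends are still joined without it. Using arbitrary walks
here avoids the nodup conditions on cycles; for a loop the empty walk is the offending one. -/
lemma isForest_iff_forall_mem_edges : IsForest G ↔
    ∀ (e : β) (x y : α), G.IsLink e x y → ∀ p : Walk G y x, e ∈ p.edges := by
  constructor
  · intro h e x y he p
    by_contra hp
    obtain ⟨q, hq, hqe⟩ := p.exists_isPath
    refine h x (.cons e he q) ⟨by simp, ?_, by simpa [Walk.IsPath] using hq⟩
    simp only [Walk.edges_cons, List.nodup_cons]
    exact ⟨fun h => hp (hqe h), hq.nodup_edges⟩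
  · intro h x p hp
    cases p with
    | nil => simp [Walk.IsCycle] at hp
    | cons e he p =>
      have := h e _ _ he p
      simp [Walk.IsCycle, this] at hp

lemma IsForest.of_le (hGH : G ≤ H) (hH : IsForest H) : IsForest G := by
  rw [isForest_iff_forall_mem_edges] at *
  intro e x y he p
  obtain ⟨q, hq, -⟩ := p.exists_transfer (H := H) (hGH.vertexSet_mono p.left_mem)
    (fun e _ u v huv => hGH.isLink_mono huv)
  rw [← hq]
  exact hH e x y (hGH.isLink_mono he) q

/-- The vertex sets may differ: this is used to pass between the reduced graph and the biconing,
where `0` is an additional isolated vertex. -/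
lemma IsForest.congr_isLink (h : ∀ e x y, G.IsLink e x y ↔ H.IsLink e x y) (hH : IsForest H) :
    IsForest G := by
  rw [isForest_iff_forall_mem_edges] at *
  intro e x y he p
  obtain ⟨q, hq, -⟩ := p.exists_transfer (H := H) ((h _ _ _).1 he).right_mem
    (fun e _ u v huv => (h _ _ _).1 huv)
  rw [← hq]
  exact hH e x y ((h _ _ _).1 he) q

lemma IsForest.ne_of_isLink (hG : IsForest G) {e : β} {x y : α} (h : G.IsLink e x y) : x ≠ y := by
  rintro rfl
  have := isForest_iff_forall_mem_edges.1 hG e x x h (.nil x h.left_mem)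
  simp at this

/-- However often a walk crosses `e`, its crossings can be reduced to at most one, in one of the two
directions. -/
lemma reach_restrict_insert {I : Set β} {e : β} {a b : α} (hab : G.IsLink e a b) {x y : α}
    (h : Reach (G.restrict (insert e I)) x y) :
    Reach (G.restrict I) x y ∨ (Reach (G.restrict I) x a ∧ Reach (G.restrict I) b y) ∨
      (Reach (G.restrict I) x b ∧ Reach (G.restrict I) a y) := by
  obtain ⟨p⟩ := h
  induction p with
  | nil x hx => exact Or.inl (.refl hx)
  | @cons x y z f hf p ih =>
    have ra : Reach (G.restrict I) a a := .refl hab.left_mem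
    have rb : Reach (G.restrict I) b b := .refl hab.right_mem
    obtain ⟨hfI, hf⟩ := hf
    by_cases hfI' : f ∈ I
    · have : Reach (G.restrict I) x y := .of_isLink (e := f) ⟨hfI', hf⟩
      rcases ih with h | ⟨h, h'⟩ | ⟨h, h'⟩
      · exact Or.inl (this.trans h)
      · exact Or.inr (Or.inl ⟨this.trans h, h'⟩)
      · exact Or.inr (Or.inr ⟨this.trans h, h'⟩)
    · obtain rfl : f = e := by simpa [hfI'] using hfI
      have : (x = a ∧ y = b) ∨ (x = b ∧ y = a) := hf.eq_and_eq_or_eq_and_eq hab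
      rcases this with ⟨rfl, rfl⟩ | ⟨rfl, rfl⟩ <;> rcases ih with h | ⟨h, h'⟩ | ⟨h, h'⟩ <;> tauto

/-- Adding an edge to a forest gives a forest if and only if its ends are not joined. -/
lemma isForest_restrict_insert {I : Set β} {e : β} {a b : α} (hab : G.IsLink e a b) (he : e ∉ I) :
    IsForest (G.restrict (insert e I)) ↔
      IsForest (G.restrict I) ∧ ¬ Reach (G.restrict I) a b := by
  constructor
  · intro h
    refine ⟨h.of_le (G.restrict_mono_right (Set.subset_insert _ _)), fun ⟨p⟩ => ?_⟩
    obtain ⟨q, hq, -⟩ := p.exists_transfer (H := G.restrict (insert e I)) hab.left_mem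
      (fun e _ u v huv => ⟨Or.inr huv.1, huv.2⟩)
    have := isForest_iff_forall_mem_edges.1 h e b a ⟨Or.inl rfl, hab.symm⟩ q
    rw [hq] at this
    obtain ⟨u, v, huv⟩ := p.exists_isLink_of_mem_edges this
    exact he huv.1
  · rintro ⟨h, hr⟩
    rw [isForest_iff_forall_mem_edges]
    intro f x y hf p
    by_contra hfp
    have key : ∀ (J : Set β), (∀ g ∈ p.edges, g ∈ J) → Reach (G.restrict J) y x := by
      intro J hJ
      obtain ⟨q, -⟩ := p.exists_transfer (H := G.restrict J) hf.right_mem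
        (fun e he u v huv => ⟨hJ e he, huv.2⟩)
      exact ⟨q⟩
    have hp : ∀ g ∈ p.edges, g ∈ insert e I := fun g hg => by
      obtain ⟨u, v, huv⟩ := p.exists_isLink_of_mem_edges hg
      exact huv.1
    obtain ⟨hfI, hf⟩ := hf
    by_cases hfe : f = e
    · subst hfe
      have hyx : Reach (G.restrict I) y x := key I fun g hg => by
        rcases hp g hg with rfl | h
        · exact absurd hg hfp
        · exact h
      rcases hf.eq_and_eq_or_eq_and_eq hab with ⟨rfl, rfl⟩ | ⟨rfl, rfl⟩
      · exact hr hyx.symm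
      · exact hr hyx
    · have hfI : f ∈ I := by simpa [hfe] using hfI
      -- A detour around `f` must use `e`, since `I` itself is a forest. Replacing `e` by `f` in the
      -- resulting closed walk joins `a` to `b` inside `I`.
      have hyx := key (insert e (I \ {f})) fun g hg => by
        rcases hp g hg with rfl | h
        · exact Or.inl rfl
        · exact Or.inr ⟨h, fun h' => hfp (h' ▸ hg)⟩
      have hle : G.restrict (I \ {f}) ≤ G.restrict I := G.restrict_mono_right Set.sdiff_subset
      have hxy : Reach (G.restrict I) x y := .of_isLink (e := f) ⟨hfI, hf⟩
      rcases reach_restrict_insert hab hyx with ⟨⟨q⟩⟩ | ⟨h1, h2⟩ | ⟨h1, h2⟩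
      · obtain ⟨q', hq', -⟩ := q.exists_transfer (H := G.restrict I) hf.right_mem
          (fun e he u v huv => hle.isLink_mono huv)
        have := isForest_iff_forall_mem_edges.1 h f x y ⟨hfI, hf⟩ q'
        rw [hq'] at this
        obtain ⟨u, v, huv⟩ := q.exists_isLink_of_mem_edges this
        exact huv.1.2 rfl
      · exact hr (((h1.mono hle).symm.trans hxy.symm).trans (h2.mono hle).symm)
      · exact hr (((h2.mono hle).trans hxy).trans (h1.mono hle))

end WalkBasics

/-! ### Paths in forests and their end edges -/

section ForestPaths

variable {α : Type u} {β : Type v} {G : Graph α β}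

namespace Walk

lemma exists_cons_of_head? {x y : α} {p : Walk G x y} {e : β} (h : p.edges.head? = some e) :
    ∃ (z : α) (he : G.IsLink e x z) (q : Walk G z y), p = .cons e he q := by
  cases p with
  | nil => simp at h
  | cons f hf q =>
    simp at h
    subst h
    exact ⟨_, hf, q, rfl⟩

lemma exists_isLink_of_head? {x y : α} {p : Walk G x y} {e : β} (h : p.edges.head? = some e) :
    ∃ z, G.IsLink e x z := by
  obtain ⟨z, he, -⟩ := exists_cons_of_head? h
  exact ⟨z, he⟩

lemma exists_isLink_of_getLast? {x y : α} {p : Walk G x y} {e : β}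
    (h : p.edges.getLast? = some e) : ∃ z, G.IsLink e y z := by
  refine exists_isLink_of_head? (p := p.reverse) ?_
  simpa using h

lemma edges_ne_nil {x y : α} (p : Walk G x y) (h : x ≠ y) : p.edges ≠ [] := by
  cases p with
  | nil => exact absurd rfl h
  | cons => simp

lemma edges_eq_nil_of_isPath {x : α} {p : Walk G x x} (hp : p.IsPath) : p.edges = [] := by
  cases p with
  | nil => simp
  | cons e h p =>
    simp only [IsPath, support_cons, List.nodup_cons] at hp
    exact absurd p.right_mem_support hp.1

lemma eq_of_edges_eq_nil {x y : α} {p : Walk G x y} (h : p.edges = []) : x = y := by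
  cases p with
  | nil => rfl
  | cons => simp at h

end Walk

/-- If the first edges differed, following the rest of one path and returning along the other would
join the ends of the first edge while avoiding it. -/
lemma IsForest.edges_eq_of_isPath (hG : IsForest G) {x y : α} {p q : Walk G x y}
    (hp : p.IsPath) (hq : q.IsPath) : p.edges = q.edges := by
  induction p with
  | nil x hx => simp [Walk.edges_eq_nil_of_isPath hq]
  | @cons x z y e he p ih =>
    have hp' := hp
    simp only [Walk.IsPath, Walk.support_cons, List.nodup_cons] at hp'
    cases q with
    | nil => exact absurd p.right_mem_support hp'.1
    | @cons _ w _ f hf q =>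
      have hq' := hq
      simp only [Walk.IsPath, Walk.support_cons, List.nodup_cons] at hq'
      have hep : e ∉ p.edges := fun h => hp'.1 (p.mem_support_of_mem_edges h he)
      have heq : e ∉ q.edges := fun h => hq'.1 (q.mem_support_of_mem_edges h he)
      by_cases hef : e = f
      · subst hef
        obtain rfl : z = w := by
          rcases he.eq_and_eq_or_eq_and_eq hf with ⟨-, h⟩ | ⟨rfl, h⟩
          · exact h
          · exact absurd rfl (hG.ne_of_isLink hf)
        simp [ih hp'.2 hq'.2]
      · have := isForest_iff_forall_mem_edges.1 hG e x z he
          (p.append (Walk.cons f hf q).reverse)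
        simp [hep, heq, hef] at this

/-- The subpath of a path between two of its vertices. -/
lemma Walk.IsPath.exists_subpath {x y u v : α} {p : Walk G x y} (hp : p.IsPath)
    (hu : u ∈ p.support) (hv : v ∈ p.support) :
    ∃ q : Walk G u v, q.IsPath ∧ q.length ≤ p.length ∧
      (q.length = p.length → s(u, v) = s(x, y)) := by
  have key : ∀ (u v : α) (q1 : Walk G x u) (q2 : Walk G u y), p = q1.append q2 →
      v ∈ q2.support → ∃ q : Walk G u v, q.IsPath ∧ q.length ≤ p.length ∧
      (q.length = p.length → s(u, v) = s(x, y)) := by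
    rintro u v q1 q2 rfl hv
    obtain ⟨q3, q4, rfl⟩ := q2.exists_append_of_mem_support hv
    refine ⟨q3, hp.of_append_right.of_append_left, by simp; omega, fun h => ?_⟩
    simp only [Walk.length_append] at h
    have h1 : q1.edges = [] := by
      rw [← List.length_eq_zero_iff]; change q1.length = 0; omega
    have h2 : q4.edges = [] := by
      rw [← List.length_eq_zero_iff]; change q4.length = 0; omega
    rw [Walk.eq_of_edges_eq_nil h1, Walk.eq_of_edges_eq_nil h2]
  obtain ⟨q1, q2, h⟩ := p.exists_append_of_mem_support hu
  have hv' : v ∈ q1.support ∨ v ∈ q2.support := by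
    rw [h, Walk.support_append] at hv
    rcases List.mem_append.1 hv with hv | hv
    · exact Or.inl hv
    · exact Or.inr (List.mem_of_mem_tail hv)
  rcases hv' with hv' | hv'
  · obtain ⟨q3, q4, rfl⟩ := q1.exists_append_of_mem_support hv'
    obtain ⟨q, hq, hl, he⟩ := key v u q3 (q4.append q2) (by
      rw [h]
      clear * -
      induction q3 with
      | nil => simp [Walk.append]
      | cons e h p ih => simp [Walk.append, ih])
      (by rw [Walk.support_append]; exact List.mem_append_left _ q4.right_mem_support)
    refine ⟨q.reverse, hq.reverse, by simpa using hl, fun h => ?_⟩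
    rw [Sym2.eq_swap]
    exact he (by simpa using h)
  · exact key u v q1 q2 h hv'

lemma IsForest.length_le_of_mem_support (hG : IsForest G) {x y u v : α} {p : Walk G u v}
    {q : Walk G x y} (hp : p.IsPath) (hq : q.IsPath) (hu : u ∈ q.support) (hv : v ∈ q.support) :
    p.length ≤ q.length := by
  obtain ⟨r, hr, hl, -⟩ := hq.exists_subpath hu hv
  have : p.length = r.length := by rw [Walk.length, Walk.length, hG.edges_eq_of_isPath hp hr]
  omega

/-- By uniqueness of paths, `p` is a subpath of `q`, and a subpath that is not shorter has the same
ends. This turns the minimality of a shortest root path into knowledge of its ends. -/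
lemma IsForest.sym2_eq_of_length_le (hG : IsForest G) {x y u v : α} {p : Walk G u v}
    {q : Walk G x y} (hp : p.IsPath) (hq : q.IsPath) (hu : u ∈ q.support) (hv : v ∈ q.support)
    (h : q.length ≤ p.length) : s(u, v) = s(x, y) := by
  obtain ⟨r, hr, hl, he⟩ := hq.exists_subpath hu hv
  have : p.length = r.length := by rw [Walk.length, Walk.length, hG.edges_eq_of_isPath hp hr]
  exact he (by omega)

/-- Every edge is the last edge of the path from a given vertex to one of the ends of the edge. -/
lemma IsForest.exists_isPath_getLast? (hG : IsForest G) {r x y : α} {e : β}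
    (he : G.IsLink e x y) (hr : Reach G r x) :
    ∃ (v : α) (p : Walk G r v), p.IsPath ∧ p.edges.getLast? = some e := by
  obtain ⟨p, hp⟩ := hr.exists_isPath
  -- If the path to `x` already meets `y`, its final piece from `y` to `x` can only be `e`;
  -- otherwise `e` extends it to `y`.
  by_cases hy : y ∈ p.support
  · obtain ⟨p1, p2, rfl⟩ := p.exists_append_of_mem_support hy
    have h2 := hG.edges_eq_of_isPath hp.of_append_right (q := .single e he.symm)
      (by simp [Walk.IsPath, (hG.ne_of_isLink he).symm])
    exact ⟨x, _, hp, by simp [h2]⟩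
  · refine ⟨y, p.append (.single e he), ?_, by simp⟩
    have : (p.append (.single e he)).support = p.support ++ [y] := by
      simp [Walk.support_append]
    rw [Walk.IsPath, this, List.nodup_append]
    exact ⟨hp, by simp, by rintro a ha b hb rfl; simp at hb; exact hy (hb ▸ ha)⟩

/-- Any two edges in the same component are the first and the last edge of a path. -/
lemma IsForest.exists_isPath_head?_getLast? (hG : IsForest G) {x y x' y' : α} {e f : β}
    (he : G.IsLink e x y) (hf : G.IsLink f x' y') (hr : Reach G x x') :
    ∃ (u v : α) (p : Walk G u v), p.IsPath ∧ p.edges.head? = some e ∧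
      p.edges.getLast? = some f := by
  obtain ⟨v, p, hp, hpf⟩ := hG.exists_isPath_getLast? hf hr
  by_cases hy : y ∈ p.support
  · obtain ⟨p1, p2, rfl⟩ := p.exists_append_of_mem_support hy
    have h2 := hG.edges_eq_of_isPath hp.of_append_left (q := .single e he)
      (by simp [Walk.IsPath, (hG.ne_of_isLink he)])
    exact ⟨x, v, _, hp, by simp [h2], hpf⟩
  · refine ⟨y, v, .cons e he.symm p, ?_, by simp, ?_⟩
    · simpa [Walk.IsPath, hy] using hp
    · simp [List.getLast?_cons, hpf]

/-- Each path contains the common last edge, hence the end of the other path, so neither is longer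
than the other. This makes the map from non-root vertices to last edges injective. -/
lemma IsForest.eq_of_getLast?_eq (hG : IsForest G) {r v w : α} {p : Walk G r v} {q : Walk G r w}
    (hp : p.IsPath) (hq : q.IsPath) {e : β} (hpe : p.edges.getLast? = some e)
    (hqe : q.edges.getLast? = some e) : v = w := by
  obtain ⟨z, hz⟩ := Walk.exists_isLink_of_getLast? hpe
  obtain ⟨z', hz'⟩ := Walk.exists_isLink_of_getLast? hqe
  have hv := q.mem_support_of_mem_edges (List.mem_of_getLast? hqe) hz
  have hw := p.mem_support_of_mem_edges (List.mem_of_getLast? hpe) hz'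
  have := hG.sym2_eq_of_length_le hp hq q.left_mem_support hv
    (hG.length_le_of_mem_support hq hp p.left_mem_support hw)
  rcases Sym2.eq_iff.1 this with ⟨-, h⟩ | ⟨rfl, rfl⟩
  · exact h
  · rfl

lemma Walk.mem_support_of_head? {x y u v : α} {p : Walk G x y} {q : Walk G u v} {e : β}
    (hp : p.edges.head? = some e) (he : e ∈ q.edges) : x ∈ q.support := by
  obtain ⟨z, hz⟩ := Walk.exists_isLink_of_head? hp
  exact q.mem_support_of_mem_edges he hz

lemma Walk.mem_support_of_getLast? {x y u v : α} {p : Walk G x y} {q : Walk G u v} {e : β}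
    (hp : p.edges.getLast? = some e) (he : e ∈ q.edges) : y ∈ q.support := by
  obtain ⟨z, hz⟩ := Walk.exists_isLink_of_getLast? hp
  exact q.mem_support_of_mem_edges he hz

/-- A path is determined, up to reversal, by its first and last edges. -/
lemma IsForest.sym2_eq_of_ends_eq (hG : IsForest G) {x y u v : α} {p : Walk G x y}
    {q : Walk G u v} (hp : p.IsPath) (hq : q.IsPath) {e f e' f' : β}
    (hpe : p.edges.head? = some e) (hpf : p.edges.getLast? = some f)
    (hqe : q.edges.head? = some e') (hqf : q.edges.getLast? = some f')
    (h : ({e, f} : Multiset β) = {e', f'}) : s(x, y) = s(u, v) := by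
  have h1 : ∀ g ∈ ({e, f} : Multiset β), g ∈ q.edges := by
    rw [h]
    simp [List.mem_of_head? hqe, List.mem_of_getLast? hqf]
  have h2 : ∀ g ∈ ({e', f'} : Multiset β), g ∈ p.edges := by
    rw [← h]
    simp [List.mem_of_head? hpe, List.mem_of_getLast? hpf]
  have hx := Walk.mem_support_of_head? hpe (h1 e (by simp))
  have hy := Walk.mem_support_of_getLast? hpf (h1 f (by simp))
  have hu := Walk.mem_support_of_head? hqe (h2 e' (by simp))
  have hv := Walk.mem_support_of_getLast? hqf (h2 f' (by simp))
  exact hG.sym2_eq_of_length_le hp hq hx hy (hG.length_le_of_mem_support hq hp hu hv)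

end ForestPaths

/-! ### Components and the vertex–edge bijection of a rooted tree -/

section Components

variable {α : Type u} {β : Type v} {G : Graph α β}

/-- The edges with an end in `C`. -/
def edgesIn (G : Graph α β) (C : Set α) : Set β := {e | ∃ x ∈ C, G.Inc e x}

lemma IsComponent.reach {C : Set α} (hC : IsComponent G C) {x y : α} (hx : x ∈ C) (hy : y ∈ C) :
    Reach G x y := by
  obtain ⟨z, -, rfl⟩ := hC
  exact (Reach.symm hx).trans hy

lemma IsComponent.mem_of_reach {C : Set α} (hC : IsComponent G C) {x y : α} (hx : x ∈ C)
    (h : Reach G x y) : y ∈ C := by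
  obtain ⟨z, -, rfl⟩ := hC
  exact Reach.trans hx h

lemma IsComponent.mem_iff {C : Set α} (hC : IsComponent G C) {x y : α} (hx : x ∈ C) :
    y ∈ C ↔ Reach G x y := ⟨hC.reach hx, hC.mem_of_reach hx⟩

lemma IsComponent.nonempty {C : Set α} (hC : IsComponent G C) : C.Nonempty := by
  obtain ⟨z, hz, rfl⟩ := hC
  exact ⟨z, Reach.refl hz⟩

lemma IsComponent.subset {C : Set α} (hC : IsComponent G C) : C ⊆ V(G) := by
  obtain ⟨z, hz, rfl⟩ := hC
  exact fun x hx => Reach.right_mem hx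

lemma IsComponent.eq_of_mem {C C' : Set α} (hC : IsComponent G C) (hC' : IsComponent G C') {x : α}
    (hx : x ∈ C) (hx' : x ∈ C') : C = C' := by
  ext y
  rw [hC.mem_iff hx, hC'.mem_iff hx']

lemma Walk.mem_edgesIn {C : Set α} (hC : IsComponent G C) {x y : α} (p : Walk G x y) (hx : x ∈ C)
    {e : β} (he : e ∈ p.edges) : e ∈ edgesIn G C := by
  obtain ⟨u, v, huv⟩ := p.exists_isLink_of_mem_edges he
  obtain ⟨q, r, -⟩ := p.exists_append_of_mem_support (p.mem_support_of_mem_edges he huv)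
  exact ⟨u, hC.mem_of_reach hx ⟨q⟩, v, huv⟩

lemma Walk.exists_getLast? {x y : α} (p : Walk G x y) (h : x ≠ y) :
    ∃ e, p.edges.getLast? = some e :=
  ⟨_, List.getLast?_eq_getLast_of_ne_nil (p.edges_ne_nil h)⟩

lemma Walk.exists_head? {x y : α} (p : Walk G x y) (h : x ≠ y) :
    ∃ e, p.edges.head? = some e :=
  ⟨_, List.head?_eq_some_head (p.edges_ne_nil h)⟩

/-- A property of the vertices of a tree other than the root `r` that corresponds to a property
of the edges of the tree, under the bijection sending a vertex `v` to the last edge of the path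
from `r` to `v`. -/
lemma IsForest.ncard_edgesIn_eq (hG : IsForest G) {C : Set α} (hC : IsComponent G C) {r : α}
    (hr : r ∈ C) (P : α → Prop) (Q : β → Prop)
    (hPQ : ∀ (v : α) (p : Walk G r v) (e : β), p.IsPath → p.edges.getLast? = some e →
      (Q e ↔ P v)) :
    {e ∈ edgesIn G C | Q e}.ncard = {v ∈ C \ {r} | P v}.ncard := by
  symm
  have h1 : ∀ v ∈ {v ∈ C \ {r} | P v}, ∃ (e : β) (p : Walk G r v), p.IsPath ∧
      p.edges.getLast? = some e := by
    rintro v ⟨⟨hv, hvr⟩, -⟩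
    obtain ⟨p, hp⟩ := (hC.reach hr hv).exists_isPath
    obtain ⟨e, he⟩ := p.exists_getLast? (Ne.symm hvr)
    exact ⟨e, p, hp, he⟩
  choose f hf using h1
  refine Set.ncard_congr f ?_ ?_ ?_
  · intro v hv
    obtain ⟨p, hp, he⟩ := hf v hv
    exact ⟨p.mem_edgesIn hC hr (List.mem_of_getLast? he), (hPQ v p _ hp he).2 hv.2⟩
  · intro v w hv hw h
    obtain ⟨p, hp, he⟩ := hf v hv
    obtain ⟨q, hq, he'⟩ := hf w hw
    exact hG.eq_of_getLast?_eq hp hq he (h ▸ he')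
  · rintro e ⟨⟨x, hx, y, hxy⟩, hQ⟩
    obtain ⟨v, p, hp, hpe⟩ := hG.exists_isPath_getLast? hxy (hC.reach hr hx)
    have hvr : v ≠ r := by
      rintro rfl
      simp [Walk.edges_eq_nil_of_isPath hp] at hpe
    have hv : v ∈ {v ∈ C \ {r} | P v} :=
      ⟨⟨hC.mem_of_reach hr ⟨p⟩, hvr⟩, (hPQ v p _ hp hpe).1 hQ⟩
    obtain ⟨q, hq, he⟩ := hf v hv
    refine ⟨v, hv, ?_⟩
    rw [hG.edges_eq_of_isPath hq hp, hpe] at he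
    simpa using he.symm

lemma IsForest.ncard_edgesIn_add_one (hG : IsForest G) {C : Set α} (hC : IsComponent G C)
    (hfin : C.Finite) : (edgesIn G C).ncard + 1 = C.ncard := by
  obtain ⟨r, hr⟩ := hC.nonempty
  have := hG.ncard_edgesIn_eq hC hr (fun _ => True) (fun _ => True) (by simp)
  simp only [and_true, Set.ofPred_mem_eq] at this
  rw [this, Set.ncard_sdiff_singleton_add_one hr hfin]

end Components

/-! ### Two-colouring of the vertices and the parity condition -/

section Colours

variable {α : Type u} {β : Type v} {H : Graph (Vert α) (Edge α β)} {A B : Set α}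

/-- Every vertex of `H` is in one of the two colour classes `A` and `(B \ A) ∪ {0̄}`. -/
def IsColoured (H : Graph (Vert α) (Edge α β)) (A B : Set α) : Prop :=
  ∀ v ∈ V(H), v ∉ Vert.old '' A → v ∈ Vert.old '' (B \ A) ∪ {Vert.zeroBar}

lemma notMem_of_mem_colour {v : Vert α} (h : v ∈ Vert.old '' (B \ A) ∪ {Vert.zeroBar}) :
    v ∉ Vert.old '' A := by
  rintro ⟨a, ha, rfl⟩
  rcases h with ⟨b, hb, h⟩ | h
  · cases h; exact hb.2 ha
  · cases h

lemma isBridging_iff (hH : IsColoured H A B) {e : Edge α β} {x y : Vert α} (h : H.IsLink e x y) :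
    IsBridging H A B e ↔ ¬ (x ∈ Vert.old '' A ↔ y ∈ Vert.old '' A) := by
  constructor
  · rintro ⟨u, hu, w, hw, huw⟩
    have hw' := notMem_of_mem_colour hw
    rcases h.eq_and_eq_or_eq_and_eq huw with ⟨rfl, rfl⟩ | ⟨rfl, rfl⟩ <;> tauto
  · intro hxy
    by_cases hx : x ∈ Vert.old '' A
    · exact ⟨x, hx, y, hH y h.right_mem (by tauto), h⟩
    · exact ⟨y, by tauto, x, hH x h.left_mem hx, h.symm⟩

/-- Traversing an edge changes the colour exactly when the edge is bridging, so the parity depends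
only on the ends. -/
lemma odd_bridgingCount_iff (hH : IsColoured H A B) {x y : Vert α} (p : Walk H x y) :
    Odd (bridgingCount A B p) ↔ ¬ (x ∈ Vert.old '' A ↔ y ∈ Vert.old '' A) := by
  induction p with
  | nil => simp [bridgingCount]
  | @cons x z y e h p ih =>
    have hb := isBridging_iff hH h
    by_cases he : IsBridging H A B e
    · have : bridgingCount A B (Walk.cons e h p) = bridgingCount A B p + 1 := by
        simp [bridgingCount, he]
      rw [this, Nat.odd_add_one, ih]
      have := hb.1 he
      tauto
    · have : bridgingCount A B (Walk.cons e h p) = bridgingCount A B p := by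
        simp [bridgingCount, he]
      rw [this, ih]
      tauto

/-- A path containing the edges in `Q`, and `0̄` if it is in `C`. -/
def ContainsRoots (C : Set (Vert α)) (Q : Multiset (Edge α β)) {x y : Vert α} (p : Walk H x y) :
    Prop :=
  p.IsPath ∧ (∀ e ∈ Q, e ∈ p.edges) ∧ (Vert.zeroBar ∈ C → Vert.zeroBar ∈ p.support)

/-- A shortest path containing the edges in `Q`, and `0̄` if it is in `C`, has an odd number of
bridging edges. -/
def HasOddRoots (H : Graph (Vert α) (Edge α β)) (A B : Set α) (C : Set (Vert α))
    (Q : Multiset (Edge α β)) : Prop :=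
  ∃ (x y : Vert α) (p : Walk H x y), (ContainsRoots C Q p ∧ ∀ (x' y' : Vert α) (q : Walk H x' y'),
    ContainsRoots C Q q → p.length ≤ q.length) ∧ Odd (bridgingCount A B p)

/-- If the ends of `p` lie on every path containing the roots, then `p` is a shortest such path and
all shortest ones have the same ends. The parity can therefore be read off from the ends of `p`. -/
lemma hasOddRoots_iff (hH : IsColoured H A B) (hF : IsForest H) {C : Set (Vert α)}
    {Q : Multiset (Edge α β)} {u v : Vert α} {p : Walk H u v} (hp : ContainsRoots C Q p)
    (h : ∀ (x y : Vert α) (q : Walk H x y), ContainsRoots C Q q →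
      u ∈ q.support ∧ v ∈ q.support) :
    HasOddRoots H A B C Q ↔ ¬ (u ∈ Vert.old '' A ↔ v ∈ Vert.old '' A) := by
  constructor
  · rintro ⟨x, y, q, ⟨hq, hmin⟩, hodd⟩
    rw [odd_bridgingCount_iff hH] at hodd
    obtain ⟨hu, hv⟩ := h x y q hq
    have := hF.sym2_eq_of_length_le hp.1 hq.1 hu hv (hmin _ _ p hp)
    rcases Sym2.eq_iff.1 this with ⟨rfl, rfl⟩ | ⟨rfl, rfl⟩
    · exact hodd
    · exact fun h => hodd h.symm
  · intro huv
    refine ⟨u, v, p, ⟨hp, fun x y q hq => ?_⟩, (odd_bridgingCount_iff hH p).2 huv⟩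
    obtain ⟨hu, hv⟩ := h x y q hq
    exact hF.length_le_of_mem_support hp.1 hq.1 hu hv

lemma hasOddRoots_pair_iff (hH : IsColoured H A B) (hF : IsForest H) {C : Set (Vert α)}
    (h0 : Vert.zeroBar ∉ C) {u v : Vert α} {p : Walk H u v} (hp : p.IsPath) {e f : Edge α β}
    (he : p.edges.head? = some e) (hf : p.edges.getLast? = some f) :
    HasOddRoots H A B C {e, f} ↔ ¬ (u ∈ Vert.old '' A ↔ v ∈ Vert.old '' A) := by
  refine hasOddRoots_iff hH hF (p := p) ⟨hp, ?_, fun h => absurd h h0⟩ fun x y q hq => ?_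
  · simp [List.mem_of_head? he, List.mem_of_getLast? hf]
  · exact ⟨Walk.mem_support_of_head? he (hq.2.1 e (by simp)),
      Walk.mem_support_of_getLast? hf (hq.2.1 f (by simp))⟩

/-- In a tree without `0̄`, pairs of edges on a path with an odd number of bridging edges
correspond to pairs of vertices of different colours. -/
lemma ncard_hasOddRoots_pair (hH : IsColoured H A B) (hF : IsForest H) {C : Set (Vert α)}
    (hC : IsComponent H C) (h0 : Vert.zeroBar ∉ C) :
    {Q : Multiset (Edge α β) | (∀ e ∈ Q, e ∈ edgesIn H C) ∧ Q.card = 2 ∧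
      HasOddRoots H A B C Q}.ncard = (C ∩ Vert.old '' A).ncard * (C \ Vert.old '' A).ncard := by
  rw [← Set.ncard_prod]
  symm
  have h1 : ∀ z ∈ (C ∩ Vert.old '' A) ×ˢ (C \ Vert.old '' A), ∃ (e f : Edge α β)
      (p : Walk H z.1 z.2), p.IsPath ∧ p.edges.head? = some e ∧ p.edges.getLast? = some f := by
    rintro ⟨u, v⟩ ⟨⟨hu, hu'⟩, hv, hv'⟩
    obtain ⟨p, hp⟩ := (hC.reach hu hv).exists_isPath
    have huv : u ≠ v := by rintro rfl; exact hv' hu'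
    obtain ⟨e, he⟩ := p.exists_head? huv
    obtain ⟨f, hf⟩ := p.exists_getLast? huv
    exact ⟨e, f, p, hp, he, hf⟩
  have : Nonempty (Edge α β) := ⟨.cone⟩
  choose! e f hef using h1
  -- The first and last edge coincide when the two vertices are adjacent, which accounts for doubled
  -- roots on one edge. They determine the ends up to order, and the colours fix the order.
  refine Set.ncard_congr (fun z _ => {e z, f z}) ?_ ?_ ?_
  · rintro ⟨u, v⟩ hz
    obtain ⟨p, hp, he, hf⟩ := hef _ hz
    obtain ⟨⟨hu, hu'⟩, hv, hv'⟩ := hz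
    refine ⟨?_, by simp, (hasOddRoots_pair_iff hH hF h0 hp he hf).2 (by tauto)⟩
    simp [p.mem_edgesIn hC hu (List.mem_of_head? he),
      p.mem_edgesIn hC hu (List.mem_of_getLast? hf)]
  · rintro ⟨u, v⟩ ⟨u', v'⟩ hz hz' h
    obtain ⟨p, hp, he, hf⟩ := hef _ hz
    obtain ⟨q, hq, he', hf'⟩ := hef _ hz'
    have := hF.sym2_eq_of_ends_eq hp hq he hf he' hf' h
    rcases Sym2.eq_iff.1 this with ⟨h, h'⟩ | ⟨h, h'⟩
    · exact Prod.ext h h'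
    · dsimp only at h h'
      exact absurd (h ▸ hz.1.2) hz'.2.2
  · rintro Q ⟨hQ, hcard, hodd⟩
    obtain ⟨g, k, rfl⟩ := Multiset.card_eq_two.1 hcard
    obtain ⟨x, hx, y, hxy⟩ := hQ g (by simp)
    obtain ⟨x', hx', y', hxy'⟩ := hQ k (by simp)
    obtain ⟨u, v, p, hp, hg, hk⟩ := hF.exists_isPath_head?_getLast? hxy hxy' (hC.reach hx hx')
    have huv := (hasOddRoots_pair_iff hH hF h0 hp hg hk).1 hodd
    have hu : u ∈ C := by
      obtain ⟨q, r, -⟩ := p.exists_append_of_mem_support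
        (p.mem_support_of_mem_edges (List.mem_of_head? hg) hxy)
      exact hC.mem_of_reach hx (Reach.symm ⟨q⟩)
    have hv : v ∈ C := hC.mem_of_reach hu ⟨p⟩
    by_cases hu' : u ∈ Vert.old '' A
    · have hz : (u, v) ∈ (C ∩ Vert.old '' A) ×ˢ (C \ Vert.old '' A) :=
        ⟨⟨hu, hu'⟩, hv, by tauto⟩
      obtain ⟨q, hq, he, hf⟩ := hef _ hz
      refine ⟨(u, v), hz, ?_⟩
      rw [hF.edges_eq_of_isPath hq hp] at he hf
      rw [he] at hg; rw [hf] at hk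
      simp_all
    · have hz : (v, u) ∈ (C ∩ Vert.old '' A) ×ˢ (C \ Vert.old '' A) :=
        ⟨⟨hv, by tauto⟩, hu, hu'⟩
      obtain ⟨q, hq, he, hf⟩ := hef _ hz
      refine ⟨(v, u), hz, ?_⟩
      rw [hF.edges_eq_of_isPath hq hp.reverse] at he hf
      simp only [Walk.edges_reverse, List.head?_reverse, List.getLast?_reverse] at he hf
      rw [hf] at hg; rw [he] at hk
      cases hg; cases hk
      exact Multiset.pair_comm _ _

/-- The shortest root path runs from `0̄` to the far end of `e`. As `0̄` is not in `A`, it is odd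
exactly when this far end is in `A`, and far ends are in bijection with edges. -/
lemma ncard_hasOddRoots_singleton (hH : IsColoured H A B) (hF : IsForest H) {C : Set (Vert α)}
    (hC : IsComponent H C) (h0 : Vert.zeroBar ∈ C) :
    {e ∈ edgesIn H C | HasOddRoots H A B C {e}}.ncard = (C ∩ Vert.old '' A).ncard := by
  rw [hF.ncard_edgesIn_eq hC h0 (fun v => v ∈ Vert.old '' A)]
  · congr 1
    ext v
    simp only [Set.mem_ofPred_eq, Set.mem_sdiff, Set.mem_singleton_iff, Set.mem_inter_iff]
    refine ⟨fun h => ⟨h.1.1, h.2⟩, fun h => ⟨⟨h.1, ?_⟩, h.2⟩⟩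
    rintro rfl
    simp at h
  · intro v p e hp he
    rw [hasOddRoots_iff hH hF (p := p) ⟨hp, by simp [List.mem_of_getLast? he],
      fun _ => p.left_mem_support⟩ fun x y q hq => ⟨hq.2.2 h0,
        Walk.mem_support_of_getLast? he (hq.2.1 e (by simp))⟩]
    simp

end Colours

/-! ### Acyclic edge sets of the biconing in terms of components of the reduced part -/

section BiconingForests

variable {α : Type u} {β : Type v} {G : Graph α β} {A B : Set α} {hAB : V(G) = A ∪ B}

lemma biconing_isLink {e : Edge α β} {x y : Vert α} :
    (biconing G A B hAB).IsLink e x y ↔ biconingLink G A B e x y := Iff.rfl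

lemma ne_zero_of_notMem_baseTree {e : Edge α β} {x y : Vert α}
    (h : (biconing G A B hAB).IsLink e x y) (he : e ∉ (baseTree A B : Set (Edge α β))) :
    x ≠ Vert.zero := by
  rintro rfl
  rw [biconing_isLink] at h
  cases e with
  | cone => simp [baseTree] at he
  | zeroTo a => simp [baseTree] at he; exact he h.1
  | zeroBarTo b => simp [biconingLink] at h
  | old e =>
    obtain ⟨u, v, -, h, -⟩ := h
    cases h

lemma reduced_isLink {e : Edge α β} {x y : Vert α} :
    (reduced G A B hAB).IsLink e x y ↔
      (biconing G A B hAB).IsLink e x y ∧ e ∉ (baseTree A B : Set (Edge α β)) := by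
  rw [reduced, Graph.deleteVerts_isLink, Graph.deleteEdges_isLink]
  constructor
  · exact fun h => h.1
  · exact fun h => ⟨h, ne_zero_of_notMem_baseTree h.1 h.2, ne_zero_of_notMem_baseTree h.1.symm h.2⟩

lemma vertexSet_reduced : V(reduced G A B hAB) = insert Vert.zeroBar (Vert.old '' V(G)) := by
  rw [reduced, Graph.vertexSet_deleteVerts, Graph.vertexSet_deleteEdges]
  ext x
  cases x <;> simp [biconing]

lemma mem_edgeSet_reduced {e : Edge α β} : e ∈ E(reduced G A B hAB) ↔
    e ∈ E(biconing G A B hAB) ∧ e ∉ (baseTree A B : Set (Edge α β)) := by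
  constructor
  · intro h
    obtain ⟨x, y, hxy⟩ := Graph.exists_isLink_of_mem_edgeSet h
    rw [reduced_isLink] at hxy
    exact ⟨hxy.1.edge_mem, hxy.2⟩
  · rintro ⟨h, he⟩
    obtain ⟨x, y, hxy⟩ := Graph.exists_isLink_of_mem_edgeSet h
    exact (reduced_isLink.2 ⟨hxy, he⟩).edge_mem

open Classical in
/-- The edge of the base tree joining an old vertex to `0` or `0̄`. -/
noncomputable def treeEdge (A : Set α) (a : α) : Edge α β :=
  if a ∈ A then .zeroTo a else .zeroBarTo a

open Classical in
/-- The coning vertex `0` or `0̄` of the same colour as `x`. -/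
noncomputable def apex (A : Set α) (x : Vert α) : Vert α :=
  if x ∈ Vert.old '' A then .zero else .zeroBar

lemma treeEdge_injective : Function.Injective (treeEdge A : α → Edge α β) := by
  intro a b h
  unfold treeEdge at h
  split_ifs at h <;> simpa using h

lemma treeEdge_mem_baseTree (hAB : V(G) = A ∪ B) {a : α} (ha : a ∈ V(G)) :
    (treeEdge A a : Edge α β) ∈ (baseTree A B : Set (Edge α β)) := by
  unfold treeEdge
  rw [hAB] at ha
  split_ifs with h <;> simp [baseTree, h]
  simpa [h] using ha

lemma isLink_treeEdge (hAB : V(G) = A ∪ B) {a : α} (ha : a ∈ V(G)) :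
    (biconing G A B hAB).IsLink (treeEdge A a) (apex A (.old a)) (.old a) := by
  rw [biconing_isLink]
  rw [hAB] at ha
  unfold treeEdge apex
  by_cases h : a ∈ A
  · simp [h, biconingLink]
  · have : a ∈ B := by simpa [h] using ha
    simp [h, biconingLink, this]

lemma isLink_cone : (biconing G A B hAB).IsLink .cone .zero .zeroBar := by
  rw [biconing_isLink]; simp [biconingLink]

lemma apex_zeroBar : apex A .zeroBar = (.zeroBar : Vert α) := by simp [apex]

lemma apex_eq_iff {x y : Vert α} :
    apex A x = apex A y ↔ (x ∈ Vert.old '' A ↔ y ∈ Vert.old '' A) := by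
  unfold apex
  split_ifs with h1 h2 h2 <;> simp [-Set.mem_image, h1, h2]

lemma apex_of_mem {x : Vert α} (h : x ∈ Vert.old '' A) : apex A x = .zero := if_pos h

lemma apex_of_notMem {x : Vert α} (h : x ∉ Vert.old '' A) : apex A x = .zeroBar := if_neg h

lemma apex_ne_old {x : Vert α} {a : α} : apex A x ≠ .old a := by
  unfold apex; split_ifs <;> simp

lemma mem_baseTree_iff (hAB : V(G) = A ∪ B) {e : Edge α β} :
    e ∈ (baseTree A B : Set (Edge α β)) ↔ e = .cone ∨ ∃ a ∈ V(G), e = treeEdge A a := by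
  constructor
  · rintro ((h | ⟨a, ha, rfl⟩) | ⟨b, hb, rfl⟩)
    · exact Or.inl h
    · exact Or.inr ⟨a, hAB ▸ Or.inl ha, by simp [treeEdge, ha]⟩
    · exact Or.inr ⟨b, hAB ▸ Or.inr hb.1, by simp [treeEdge, hb.2]⟩
  · rintro (rfl | ⟨a, ha, rfl⟩)
    · simp [baseTree]
    · exact treeEdge_mem_baseTree hAB ha

/-- The set `S` together with `0̄`. -/
def rooted (S : Set α) : Set (Vert α) := insert .zeroBar (Vert.old '' S)

lemma zeroBar_mem_rooted {S : Set α} : Vert.zeroBar ∈ rooted S := Or.inl rfl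

lemma old_mem_rooted {S : Set α} {a : α} : Vert.old a ∈ rooted S ↔ a ∈ S := by simp [rooted]

lemma rooted_mono {S T : Set α} (h : S ⊆ T) : rooted S ⊆ rooted T :=
  Set.insert_subset_insert (Set.image_mono h)

variable {F : Set (Edge α β)} {S : Set α}

lemma reduced_restrict_isLink (hF : F ⊆ E(reduced G A B hAB)) {e : Edge α β} {x y : Vert α} :
    ((reduced G A B hAB).restrict F).IsLink e x y ↔
      ((biconing G A B hAB).restrict F).IsLink e x y := by
  simp only [Graph.restrict_isLink, reduced_isLink]
  refine ⟨fun h => ⟨h.1, h.2.1⟩, fun h => ⟨h.1, h.2, (mem_edgeSet_reduced.1 (hF h.1)).2⟩⟩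

lemma not_reach_zero {x : Vert α} : ¬ Reach ((reduced G A B hAB).restrict F) .zero x := by
  intro h
  have := h.left_mem
  rw [Graph.vertexSet_restrict, vertexSet_reduced] at this
  simp at this

lemma reach_biconing_of_reach_reduced {x y : Vert α}
    (h : Reach ((reduced G A B hAB).restrict F) x y) :
    Reach ((biconing G A B hAB).restrict (F ∪ treeEdge A '' S)) x y := by
  refine h.mono ⟨?_, ?_⟩
  · simp only [Graph.vertexSet_restrict, vertexSet_reduced]
    intro x hx
    cases x <;> simp [biconing] at hx ⊢; exact hx
  · intro e x y hxy
    exact ⟨Or.inl hxy.1, (reduced_isLink.1 hxy.2).1⟩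

lemma reach_apex (hS : S ⊆ V(G)) {x : Vert α} (hx : x ∈ rooted S) :
    Reach ((biconing G A B hAB).restrict (F ∪ treeEdge A '' S)) (apex A x) x := by
  rcases hx with rfl | ⟨a, ha, rfl⟩
  · rw [apex_zeroBar]
    exact .refl (by simp [biconing])
  · exact .of_isLink (e := treeEdge A a) ⟨Or.inr ⟨a, ha, rfl⟩, isLink_treeEdge hAB (hS ha)⟩

lemma treeEdge_notMem (hF : F ⊆ E(reduced G A B hAB)) {a : α} (ha : a ∈ V(G)) (haS : a ∉ S) :
    treeEdge A a ∉ F ∪ treeEdge A '' S := by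
  rintro (h | ⟨b, hb, h⟩)
  · exact (mem_edgeSet_reduced.1 (hF h)).2 (treeEdge_mem_baseTree hAB ha)
  · exact haS (treeEdge_injective h ▸ hb)

lemma not_reach_apex (hF : F ⊆ E(reduced G A B hAB)) (hS : S ⊆ V(G))
    (h : IsForest ((biconing G A B hAB).restrict (F ∪ treeEdge A '' S))) {a : α} (ha : a ∈ S) :
    ¬ Reach ((biconing G A B hAB).restrict (F ∪ treeEdge A '' (S \ {a})))
      (apex A (.old a)) (.old a) := by
  have : F ∪ treeEdge A '' S = insert (treeEdge A a) (F ∪ treeEdge A '' (S \ {a})) := by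
    rw [← Set.union_insert, ← Set.image_insert_eq, Set.insert_sdiff_singleton,
      Set.insert_eq_of_mem ha]
  rw [this, isForest_restrict_insert (isLink_treeEdge hAB (hS ha))
    (treeEdge_notMem hF (hS ha) (by simp))] at h
  exact h.2

/-- The elements of `S` and `0̄` lie in different components, except that at most one component
contains two elements, of different colours. -/
structure IsNearTransversal (H : Graph (Vert α) (Edge α β)) (A : Set α) (S' : Set (Vert α)) :
    Prop where
  eq_of_colour_eq : ∀ x ∈ S', ∀ y ∈ S', (x ∈ Vert.old '' A ↔ y ∈ Vert.old '' A) → Reach H x y →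
    x = y
  reach_of_ne : ∀ x ∈ S', ∀ y ∈ S', ∀ x' ∈ S', ∀ y' ∈ S', x ≠ y → x' ≠ y' → Reach H x y →
    Reach H x' y' → Reach H x x'

lemma mem_rooted_sdiff {a : α} {x : Vert α} (hx : x ∈ rooted S) (h : x ≠ .old a) :
    x ∈ rooted (S \ {a}) := by
  rcases hx with rfl | ⟨b, hb, rfl⟩
  · exact zeroBar_mem_rooted
  · exact old_mem_rooted.2 ⟨hb, fun h' => h (congrArg _ h')⟩

lemma IsForest.isNearTransversal (hF : F ⊆ E(reduced G A B hAB)) (hS : S ⊆ V(G))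
    (h : IsForest ((biconing G A B hAB).restrict (F ∪ treeEdge A '' S))) :
    IsNearTransversal ((reduced G A B hAB).restrict F) A (rooted S) := by
  -- Two marked vertices of one colour joined in `F` close a cycle through their common apex. The
  -- tree edge at `x` is the one shown not to be a bridge, hence `x ≠ 0̄`.
  have key : ∀ x ∈ rooted S, ∀ y ∈ rooted S, (x ∈ Vert.old '' A ↔ y ∈ Vert.old '' A) →
      Reach ((reduced G A B hAB).restrict F) x y → x ≠ y → x ≠ .zeroBar → False := by
    rintro x (rfl | ⟨a, ha, rfl⟩) y hy hc hr hne hx0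
    · exact hx0 rfl
    · refine not_reach_apex hF hS h ha ?_
      rw [apex_eq_iff.2 hc]
      exact (reach_apex (Set.sdiff_subset.trans hS) (mem_rooted_sdiff hy hne.symm)).trans
        (reach_biconing_of_reach_reduced hr.symm)
  have h1 : ∀ x ∈ rooted S, ∀ y ∈ rooted S, (x ∈ Vert.old '' A ↔ y ∈ Vert.old '' A) →
      Reach ((reduced G A B hAB).restrict F) x y → x = y := by
    intro x hx y hy hc hr
    by_contra hne
    by_cases hx0 : x = .zeroBar
    · exact key y hy x hx hc.symm hr.symm (Ne.symm hne) (by rintro rfl; exact hne hx0)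
    · exact key x hx y hy hc hr hne hx0
  -- Two different components, each with marked vertices of both colours, close the cycle `0, x',
  -- y', 0̄, y, x, 0`, where stretches inside `F` are abbreviated and `0̄` may coincide with `y` or
  -- `y'`.
  have h2 : ∀ x ∈ rooted S, ∀ y ∈ rooted S, ∀ x' ∈ rooted S, ∀ y' ∈ rooted S,
      x ∈ Vert.old '' A → y ∉ Vert.old '' A → x' ∈ Vert.old '' A → y' ∉ Vert.old '' A →
      Reach ((reduced G A B hAB).restrict F) x y → Reach ((reduced G A B hAB).restrict F) x' y' →
      Reach ((reduced G A B hAB).restrict F) x x' := by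
    intro x hx y hy x' hx' y' hy' hxA hyA hxA' hyA' hr hr'
    by_contra hxx
    obtain ⟨a, ha, rfl⟩ := id hxA
    have haS := old_mem_rooted.1 hx
    refine not_reach_apex hF hS h haS ?_
    have hS' := Set.sdiff_subset (t := {a}).trans hS
    have ne1 : y ≠ .old a := fun h => hyA (h ▸ hxA)
    have ne2 : y' ≠ .old a := fun h => hyA' (h ▸ hxA)
    have ne3 : x' ≠ .old a := by rintro rfl; exact hxx (.refl hr.left_mem)
    have e1 := reach_apex (F := F) (hAB := hAB) hS' (mem_rooted_sdiff hy ne1)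
    have e2 := reach_apex (F := F) (hAB := hAB) hS' (mem_rooted_sdiff hy' ne2)
    have e3 := reach_apex (F := F) (hAB := hAB) hS' (mem_rooted_sdiff hx' ne3)
    rw [apex_of_notMem hyA] at e1
    rw [apex_of_notMem hyA'] at e2
    rw [apex_of_mem hxA'] at e3
    rw [apex_of_mem hxA]
    exact (((e3.trans (reach_biconing_of_reach_reduced hr')).trans e2.symm).trans e1).trans
      (reach_biconing_of_reach_reduced hr.symm)
  refine ⟨h1, fun x hx y hy x' hx' y' hy' hne hne' hr hr' => ?_⟩
  have c1 : ¬ (x ∈ Vert.old '' A ↔ y ∈ Vert.old '' A) := fun hc => hne (h1 x hx y hy hc hr)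
  have c2 : ¬ (x' ∈ Vert.old '' A ↔ y' ∈ Vert.old '' A) :=
    fun hc => hne' (h1 x' hx' y' hy' hc hr')
  by_cases hxA : x ∈ Vert.old '' A <;> by_cases hxA' : x' ∈ Vert.old '' A
  · exact h2 x hx y hy x' hx' y' hy' hxA (by tauto) hxA' (by tauto) hr hr'
  · exact (h2 x hx y hy y' hy' x' hx' hxA (by tauto) (by tauto) hxA' hr hr'.symm).trans hr'.symm
  · exact hr.trans (h2 y hy x hx x' hx' y' hy' (by tauto) hxA hxA' (by tauto) hr.symm hr')
  · exact (hr.trans (h2 y hy x hx y' hy' x' hx' (by tauto) hxA (by tauto) hxA' hr.symm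
      hr'.symm)).trans hr'.symm

lemma IsNearTransversal.mono {H : Graph (Vert α) (Edge α β)} {S' T' : Set (Vert α)}
    (h : IsNearTransversal H A T') (hST : S' ⊆ T') : IsNearTransversal H A S' :=
  ⟨fun x hx y hy => h.eq_of_colour_eq x (hST hx) y (hST hy),
    fun x hx y hy x' hx' y' hy' => h.reach_of_ne x (hST hx) y (hST hy) x' (hST hx') y' (hST hy')⟩

/-- A set of vertices is closed under adjacency in the biconing if it is closed under adjacency in
the reduced graph and under the edges of the base tree. -/
lemma reach_mem_of_closed (hF : F ⊆ E(reduced G A B hAB)) (hS : S ⊆ V(G)) {K : Set (Vert α)}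
    (h1 : ∀ x ∈ K, ∀ y, Reach ((reduced G A B hAB).restrict F) x y → y ∈ K)
    (h2 : ∀ a ∈ S, (.old a ∈ K ↔ apex A (.old a) ∈ K)) {x y : Vert α} (hx : x ∈ K)
    (h : Reach ((biconing G A B hAB).restrict (F ∪ treeEdge A '' S)) x y) : y ∈ K := by
  refine h.mem_of_closed ?_ hx
  rintro e u v ⟨he | ⟨a, ha, rfl⟩, huv⟩ hu
  · exact h1 u hu v (.of_isLink ((reduced_restrict_isLink hF).2 ⟨he, huv⟩))
  · rcases huv.eq_and_eq_or_eq_and_eq (isLink_treeEdge hAB (hS ha)) with ⟨rfl, rfl⟩ | ⟨rfl, rfl⟩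
    · exact (h2 a ha).2 hu
    · exact (h2 a ha).1 hu

/-- Separation is shown by a set that contains `a`, omits its apex, and is closed under adjacency.
-/
lemma IsNearTransversal.not_reach_apex (hF : F ⊆ E(reduced G A B hAB)) (hS : S ⊆ V(G)) {a : α}
    (haS : a ∉ S)
    (h : IsNearTransversal ((reduced G A B hAB).restrict F) A (rooted (insert a S))) :
    ¬ Reach ((biconing G A B hAB).restrict (F ∪ treeEdge A '' S)) (apex A (.old a)) (.old a) := by
  intro hr
  have hr := hr.symm
  have hsub : rooted S ⊆ rooted (insert a S) := rooted_mono (Set.subset_insert _ _)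
  have ha' : Vert.old a ∈ rooted (insert a S) := old_mem_rooted.2 (Or.inl rfl)
  have haV : Reach ((reduced G A B hAB).restrict F) (.old a) (.old a) := by
    refine .refl ?_
    have := hr.left_mem
    simp only [Graph.vertexSet_restrict, vertexSet_reduced] at this ⊢
    simpa [biconing] using this
  by_cases hy : ∃ y ∈ rooted S, Reach ((reduced G A B hAB).restrict F) (.old a) y
  · obtain ⟨y, hyS, hay⟩ := hy
    have hya : y ≠ .old a := by rintro rfl; exact haS (old_mem_rooted.1 hyS)
    have hc : ¬ (Vert.old a ∈ Vert.old '' A ↔ y ∈ Vert.old '' A) :=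
      fun hc => hya (h.eq_of_colour_eq _ ha' _ (hsub hyS) hc hay).symm
    -- The component of `a` and `y` is already the exceptional one, so a marked vertex of the colour
    -- of `a` is alone in its component.
    have key : ∀ b ∈ rooted S, (b ∈ Vert.old '' A ↔ Vert.old a ∈ Vert.old '' A) →
        ∀ z ∈ rooted S, b ≠ z → ¬ Reach ((reduced G A B hAB).restrict F) b z := by
      intro b hb hbc z hz hbz hr
      have := h.reach_of_ne b (hsub hb) z (hsub hz) _ ha' y (hsub hyS) hbz hya.symm hr hay
      have := h.eq_of_colour_eq _ (hsub hb) _ ha' hbc this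
      exact haS (old_mem_rooted.1 (this ▸ hb))
    -- Everything hanging on the apex opposite to that of `a`: this apex and all components with a
    -- marked vertex of the colour of `y`.
    let K : Set (Vert α) := {v | v = apex A y ∨ ∃ z ∈ rooted S,
      (z ∈ Vert.old '' A ↔ y ∈ Vert.old '' A) ∧ Reach ((reduced G A B hAB).restrict F) v z}
    have hK0 : apex A (.old a) ∉ K := by
      rintro (h' | ⟨z, hz, hzc, hr'⟩)
      · exact hc (apex_eq_iff.1 h')
      · by_cases haA : Vert.old a ∈ Vert.old '' A
        · rw [apex_of_mem haA] at hr'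
          exact not_reach_zero hr'
        · rw [apex_of_notMem haA] at hr'
          refine key .zeroBar zeroBar_mem_rooted (by simpa using haA) z hz ?_ hr'
          rintro rfl
          simp at hzc haA
          simp [haA] at hc
          tauto
    refine hK0 (reach_mem_of_closed hF hS ?_ ?_ (K := K) ?_ hr)
    · rintro x (rfl | ⟨z, hz, hzc, hr'⟩) w hw
      · by_cases hyA : y ∈ Vert.old '' A
        · rw [apex_of_mem hyA] at hw
          exact absurd hw not_reach_zero
        · rw [apex_of_notMem hyA] at hw
          exact Or.inr ⟨.zeroBar, zeroBar_mem_rooted, by simpa using hyA, hw.symm⟩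
      · exact Or.inr ⟨z, hz, hzc, hw.symm.trans hr'⟩
    · intro b hb
      have hbS : Vert.old b ∈ rooted S := old_mem_rooted.2 hb
      have hbr : Reach ((reduced G A B hAB).restrict F) (.old b) (.old b) := by
        refine .refl ?_
        simp [vertexSet_reduced, hS hb]
      by_cases hbc : (Vert.old b ∈ Vert.old '' A ↔ y ∈ Vert.old '' A)
      · exact ⟨fun _ => Or.inl (apex_eq_iff.2 hbc), fun _ => Or.inr ⟨_, hbS, hbc, hbr⟩⟩
      · have hab : Vert.old b ∈ Vert.old '' A ↔ Vert.old a ∈ Vert.old '' A := by tauto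
        refine ⟨?_, fun h' => absurd h' ?_⟩
        · rintro (h' | ⟨z, hz, hzc, hr'⟩)
          · exact absurd h'.symm apex_ne_old
          · exact absurd hr' (key _ hbS hab z hz (by rintro rfl; exact hbc hzc))
        · rwa [apex_eq_iff.2 hab]
    · exact Or.inr ⟨y, hyS, Iff.rfl, hay⟩
  · push Not at hy
    -- The component of `a` has no marked vertex, so no tree edge of `S` leaves it and it is itself
    -- closed.
    have : apex A (.old a) ∈ {v | Reach ((reduced G A B hAB).restrict F) (.old a) v} := by
      refine reach_mem_of_closed (K := {v | Reach ((reduced G A B hAB).restrict F) (.old a) v})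
        hF hS (fun x hx y hy => Reach.trans hx hy) ?_ haV hr
      intro b hb
      refine ⟨fun h' => absurd h' (hy _ (old_mem_rooted.2 hb)), fun h' => ?_⟩
      by_cases hbA : Vert.old b ∈ Vert.old '' A
      · rw [apex_of_mem hbA] at h'
        exact absurd (Reach.symm h') not_reach_zero
      · rw [apex_of_notMem hbA] at h'
        exact absurd h' (hy _ zeroBar_mem_rooted)
    by_cases haA : Vert.old a ∈ Vert.old '' A
    · rw [apex_of_mem haA] at this
      exact absurd (Reach.symm this) not_reach_zero
    · rw [apex_of_notMem haA] at this
      exact hy _ zeroBar_mem_rooted this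

lemma isForest_reduced_of_biconing (hF : F ⊆ E(reduced G A B hAB)) {I : Set (Edge α β)}
    (hFI : F ⊆ I) (h : IsForest ((biconing G A B hAB).restrict I)) :
    IsForest ((reduced G A B hAB).restrict F) :=
  (h.of_le (Graph.restrict_mono_right _ hFI)).congr_isLink fun _ _ _ => reduced_restrict_isLink hF

/-- Forests of the biconing that do not contain the edge `00̄`. -/
lemma isForest_biconing_iff (hF : F ⊆ E(reduced G A B hAB)) (hS : S ⊆ V(G)) (hfin : S.Finite) :
    IsForest ((biconing G A B hAB).restrict (F ∪ treeEdge A '' S)) ↔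
      IsForest ((reduced G A B hAB).restrict F) ∧
        IsNearTransversal ((reduced G A B hAB).restrict F) A (rooted S) := by
  refine ⟨fun h => ⟨isForest_reduced_of_biconing hF Set.subset_union_left h,
    h.isNearTransversal hF hS⟩, ?_⟩
  rintro ⟨hf, h⟩
  -- The condition passes to subsets of `S`, so tree edges can be inserted one by one, each joining
  -- two components.
  induction S, hfin using Set.Finite.induction_on with
  | empty =>
    rw [Set.image_empty, Set.union_empty]
    exact hf.congr_isLink fun _ _ _ => (reduced_restrict_isLink hF).symm
  | @insert a S ha _ ih =>
    have haV : a ∈ V(G) := hS (Set.mem_insert _ _)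
    have hSV : S ⊆ V(G) := (Set.subset_insert _ _).trans hS
    rw [Set.image_insert_eq, Set.union_insert,
      isForest_restrict_insert (isLink_treeEdge hAB haV) (treeEdge_notMem hF haV ha)]
    exact ⟨ih hSV (h.mono (rooted_mono (Set.subset_insert _ _))), h.not_reach_apex hF hSV ha⟩

/-- Forests of the biconing that contain the edge `00̄`. -/
lemma isForest_biconing_insert_cone_iff (hF : F ⊆ E(reduced G A B hAB)) (hS : S ⊆ V(G))
    (hfin : S.Finite) :
    IsForest ((biconing G A B hAB).restrict (insert .cone (F ∪ treeEdge A '' S))) ↔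
      IsForest ((reduced G A B hAB).restrict F) ∧ ∀ x ∈ rooted S, ∀ y ∈ rooted S,
        Reach ((reduced G A B hAB).restrict F) x y → x = y := by
  have hcone : Edge.cone ∉ F ∪ treeEdge A '' S := by
    rintro (h | ⟨a, -, h⟩)
    · exact (mem_edgeSet_reduced.1 (hF h)).2 (by simp [baseTree])
    · unfold treeEdge at h
      split_ifs at h
  rw [isForest_restrict_insert isLink_cone hcone, isForest_biconing_iff hF hS hfin]
  constructor
  · rintro ⟨⟨hf, h⟩, h0⟩
    refine ⟨hf, fun x hx y hy hr => h.eq_of_colour_eq x hx y hy ?_ hr⟩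
    by_contra hc
    -- A component with marks of both colours would join `0` to `0̄` without the edge `00̄`.
    have key : ∀ x ∈ rooted S, ∀ y ∈ rooted S, x ∈ Vert.old '' A → y ∉ Vert.old '' A →
        ¬ Reach ((reduced G A B hAB).restrict F) x y := by
      intro x hx y hy hxA hyA hr
      have e1 := reach_apex (F := F) (hAB := hAB) hS hx
      have e2 := reach_apex (F := F) (hAB := hAB) hS hy
      rw [apex_of_mem hxA] at e1
      rw [apex_of_notMem hyA] at e2
      exact h0 ((e1.trans (reach_biconing_of_reach_reduced hr)).trans e2.symm)
    by_cases hxA : x ∈ Vert.old '' A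
    · exact key x hx y hy hxA (by tauto) hr
    · exact key y hy x hx (by tauto) hxA hr.symm
  · rintro ⟨hf, h⟩
    refine ⟨⟨hf, fun x hx y hy _ => h x hx y hy,
      fun x hx y hy _ _ _ _ hne _ hr => absurd (h x hx y hy hr) hne⟩, fun hr => ?_⟩
    -- The components with a marked vertex outside `A` form a closed set containing `0̄`. It omits
    -- `0`, which is not a vertex of the reduced graph.
    have : Vert.zero ∈ {v | ∃ z ∈ rooted S, z ∉ Vert.old '' A ∧
        Reach ((reduced G A B hAB).restrict F) v z} := by
      refine reach_mem_of_closed hF hS ?_ ?_ ?_ hr.symm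
      · rintro x ⟨z, hz, hzA, hr⟩ w hw
        exact ⟨z, hz, hzA, hw.symm.trans hr⟩
      · intro b hb
        have hbS : Vert.old b ∈ rooted S := old_mem_rooted.2 hb
        have hbr : Reach ((reduced G A B hAB).restrict F) (.old b) (.old b) := by
          refine .refl ?_
          simp [vertexSet_reduced, hS hb]
        by_cases hbA : Vert.old b ∈ Vert.old '' A
        · rw [apex_of_mem hbA]
          refine ⟨?_, fun ⟨z, _, _, h⟩ => absurd h not_reach_zero⟩
          rintro ⟨z, hz, hzA, hr⟩
          exact absurd (h _ hbS _ hz hr ▸ hbA) hzA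
        · rw [apex_of_notMem hbA]
          exact ⟨fun _ => ⟨.zeroBar, zeroBar_mem_rooted, by simp, .refl (by
            simp [vertexSet_reduced])⟩, fun _ => ⟨_, hbS, hbA, hbr⟩⟩
      · exact ⟨.zeroBar, zeroBar_mem_rooted, by simp, .refl (by simp [vertexSet_reduced])⟩
    obtain ⟨z, -, -, h⟩ := this
    exact not_reach_zero h

end BiconingForests

/-! ### Dual-number weights and factorisation over components -/

section Weights

open Classical in
-- The predicates `q k` partition `N` into blocks, and a submultiset of `N` is an independent choice
-- of a submultiset of each block. The induction splits off one block at a time.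
lemma sum_Iic_prod_filter {ι κ M : Type*} [CommSemiring M] (K : Finset κ) (q : κ → ι → Prop)
    (N : Multiset ι) (hN : ∀ i ∈ N, ∃! k, k ∈ K ∧ q k i) (w : κ → Multiset ι → M) :
    ∑ R ∈ Finset.Iic N, ∏ k ∈ K, w k (R.filter (q k)) =
      ∏ k ∈ K, ∑ T ∈ Finset.Iic (N.filter (q k)), w k T := by
  induction K using Finset.induction_on generalizing N with
  | empty =>
    have : N = 0 := Multiset.eq_zero_of_forall_notMem fun i hi => by
      obtain ⟨k, ⟨hk, -⟩, -⟩ := hN i hi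
      simp at hk
    subst this
    have : Finset.Iic (0 : Multiset ι) = {0} := by
      ext T; simp
    simp [this]
  | insert k₀ K hk₀ ih =>
    have hN' : ∀ i ∈ N.filter (fun i => ¬ q k₀ i), ∃! k, k ∈ K ∧ q k i := by
      intro i hi
      rw [Multiset.mem_filter] at hi
      obtain ⟨k, ⟨hk, hki⟩, huniq⟩ := hN i hi.1
      have hkk : k ≠ k₀ := by rintro rfl; exact hi.2 hki
      exact ⟨k, ⟨(Finset.mem_insert.1 hk).resolve_left hkk, hki⟩,
        fun k' hk' => huniq k' ⟨Finset.mem_insert_of_mem hk'.1, hk'.2⟩⟩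
    have hdisj : ∀ k ∈ K, ∀ i ∈ N, q k i → ¬ q k₀ i := by
      intro k hk i hi hki hk₀i
      have := (hN i hi).unique ⟨Finset.mem_insert_of_mem hk, hki⟩
        ⟨Finset.mem_insert_self _ _, hk₀i⟩
      exact hk₀ (this ▸ hk)
    have hfilter : ∀ k ∈ K, ∀ R ≤ N,
        (R.filter (fun i => ¬ q k₀ i)).filter (q k) = R.filter (q k) := by
      intro k hk R hR
      rw [Multiset.filter_filter]
      refine Multiset.filter_congr fun i hi => ?_
      exact ⟨fun h => h.1, fun h => ⟨h, hdisj k hk i (Multiset.mem_of_le hR hi) h⟩⟩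
    rw [Finset.prod_insert hk₀]
    have ih' := ih (N.filter (fun i => ¬ q k₀ i)) hN'
    have e1 : ∏ k ∈ K, ∑ T ∈ Finset.Iic (N.filter (q k)), w k T =
        ∏ k ∈ K, ∑ T ∈ Finset.Iic ((N.filter (fun i => ¬ q k₀ i)).filter (q k)), w k T :=
      Finset.prod_congr rfl fun k hk => by rw [hfilter k hk N le_rfl]
    rw [e1, ← ih', Finset.sum_mul_sum, ← Finset.sum_product']
    refine Finset.sum_bij' (fun R _ => (R.filter (q k₀), R.filter (fun i => ¬ q k₀ i)))
      (fun z _ => z.1 + z.2) ?_ ?_ ?_ ?_ ?_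
    · intro R hR
      rw [Finset.mem_Iic] at hR
      simp only [Finset.mem_product, Finset.mem_Iic]
      exact ⟨Multiset.filter_le_filter _ hR, Multiset.filter_le_filter _ hR⟩
    · rintro ⟨S, T⟩ h
      simp only [Finset.mem_product, Finset.mem_Iic] at h ⊢
      rw [← Multiset.filter_add_not (q k₀) N]
      exact add_le_add h.1 h.2
    · intro R hR
      exact Multiset.filter_add_not _ _
    · rintro ⟨S, T⟩ h
      simp only [Finset.mem_product, Finset.mem_Iic] at h
      have h1 : ∀ i ∈ S, q k₀ i := fun i hi =>
        (Multiset.mem_filter.1 (Multiset.mem_of_le h.1 hi)).2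
      have h2 : ∀ i ∈ T, ¬ q k₀ i := fun i hi =>
        (Multiset.mem_filter.1 (Multiset.mem_of_le h.2 hi)).2
      simp only [Multiset.filter_add]
      rw [Multiset.filter_eq_self.2 h1, Multiset.filter_eq_nil.2 h2,
        Multiset.filter_eq_self.2 h2, Multiset.filter_eq_nil.2 (fun i hi h => h (h1 i hi))]
      simp
    · intro R hR
      rw [Finset.mem_Iic] at hR
      rw [Finset.prod_insert hk₀]
      congr 1
      exact Finset.prod_congr rfl fun k hk => by rw [hfilter k hk R hR]

open Classical in
lemma sum_card_filter {ι κ : Type*} (K : Finset κ) (q : κ → ι → Prop) (R : Multiset ι)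
    (hR : ∀ i ∈ R, ∃! k, k ∈ K ∧ q k i) :
    ∑ k ∈ K, (R.filter (q k)).card = R.card := by
  induction R using Multiset.induction_on with
  | empty => simp
  | cons i R ih =>
    obtain ⟨k₀, ⟨hk₀, hk₀i⟩, huniq⟩ := hR i (Multiset.mem_cons_self _ _)
    have h : ∀ k ∈ K, ((i ::ₘ R).filter (q k)).card =
        (R.filter (q k)).card + if k = k₀ then 1 else 0 := by
      intro k hk
      by_cases hki : q k i
      · have : k = k₀ := huniq k ⟨hk, hki⟩
        rw [Multiset.filter_cons_of_pos _ hki]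
        simp [this]
      · have : k ≠ k₀ := by rintro rfl; exact hki hk₀i
        rw [Multiset.filter_cons_of_neg _ hki]
        simp [this]
    rw [Finset.sum_congr rfl h, Finset.sum_add_distrib,
      ih fun i hi => hR i (Multiset.mem_cons_of_mem hi)]
    simp [hk₀]

variable {R : Type*} [CommRing R]

open TrivSqZeroExt

open Classical in
/-- The weight of a component with `n` marked elements, where `P` has to hold if `n = 2`. -/
noncomputable def stateWeight (x : R) (n : ℕ) (P : Prop) : DualNumber R :=
  if n = 0 then inl x else if n = 1 then 1 else if n = 2 ∧ P then DualNumber.eps else 0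

/-- All components have at most two marked elements, and at most one has two of them. -/
structure IsAdmissible {κ : Type*} (K : Finset κ) (n : κ → ℕ) (P : κ → Prop) : Prop where
  le_two : ∀ k ∈ K, n k ≤ 2
  prop_of_eq_two : ∀ k ∈ K, n k = 2 → P k
  eq_of_eq_two : ∀ k ∈ K, ∀ k' ∈ K, n k = 2 → n k' = 2 → k = k'

lemma sum_le_card_of_le_one {κ : Type*} {K : Finset κ} {n : κ → ℕ} (h : ∀ k ∈ K, n k ≤ 1) :
    ∑ k ∈ K, n k ≤ K.card := by
  simpa using Finset.sum_le_card_nsmul K n 1 h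

lemma stateWeight_of_le_one (x : R) {n : ℕ} (P : Prop) (h : n ≤ 1) :
    stateWeight x n P = inl (x ^ (1 - n)) := by
  unfold stateWeight
  interval_cases n <;> simp

lemma fst_stateWeight_of_two_le (x : R) {n : ℕ} (P : Prop) (h : 2 ≤ n) :
    (stateWeight x n P).fst = 0 := by
  unfold stateWeight
  rw [if_neg (by omega), if_neg (by omega)]
  split_ifs <;> simp

lemma fst_finsetProd {κ : Type*} (K : Finset κ) (f : κ → DualNumber R) :
    (∏ k ∈ K, f k).fst = ∏ k ∈ K, (f k).fst :=
  map_prod (fstHom R R R) f K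

lemma prod_stateWeight_of_le_one {κ : Type*} (x : R) (K : Finset κ) (n : κ → ℕ) (P : κ → Prop)
    (h : ∀ k ∈ K, n k ≤ 1) :
    ∏ k ∈ K, stateWeight x (n k) (P k) = inl (x ^ (K.card - ∑ k ∈ K, n k)) := by
  have h1 : ∑ k ∈ K, (1 - n k) = K.card - ∑ k ∈ K, n k := by
    have : ∑ k ∈ K, (1 - n k) + ∑ k ∈ K, n k = K.card := by
      rw [← Finset.sum_add_distrib, Finset.card_eq_sum_ones]
      exact Finset.sum_congr rfl fun k hk => by have := h k hk; omega
    omega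
  rw [Finset.prod_congr rfl fun k hk => stateWeight_of_le_one x (P k) (h k hk), ← h1,
    ← Finset.prod_pow_eq_pow_sum]
  exact (map_prod (inlHom R R) _ K).symm

open Classical in
-- Setting `ε = 0` removes every state with a component having two or more marks; the exponent is
-- then the number of empty components.
lemma fst_prod_stateWeight {κ : Type*} (x : R) (K : Finset κ) (n : κ → ℕ) (P : κ → Prop) :
    (∏ k ∈ K, stateWeight x (n k) (P k)).fst =
      if ∀ k ∈ K, n k ≤ 1 then x ^ (K.card - ∑ k ∈ K, n k) else 0 := by
  split_ifs with h
  · rw [prod_stateWeight_of_le_one x K n P h, fst_inl]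
  · push Not at h
    obtain ⟨k, hk, hk2⟩ := h
    rw [fst_finsetProd]
    exact Finset.prod_eq_zero hk (fst_stateWeight_of_two_le x _ hk2)

lemma IsAdmissible.le_one_of_ne {κ : Type*} {K : Finset κ} {n : κ → ℕ} {P : κ → Prop}
    (h : IsAdmissible K n P) {k₀ : κ} (hk₀ : k₀ ∈ K) (h2 : n k₀ = 2) {k : κ} (hk : k ∈ K)
    (hne : k ≠ k₀) : n k ≤ 1 := by
  by_contra hlt
  have := h.le_two k hk
  exact hne (h.eq_of_eq_two k hk k₀ hk₀ (by omega) h2)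

lemma IsAdmissible.sum_le {κ : Type*} {K : Finset κ} {n : κ → ℕ} {P : κ → Prop}
    (h : IsAdmissible K n P) : ∑ k ∈ K, n k ≤ K.card + 1 := by
  classical
  by_cases h1 : ∀ k ∈ K, n k ≤ 1
  · have := sum_le_card_of_le_one h1
    omega
  · push Not at h1
    obtain ⟨k₀, hk₀, hlt⟩ := h1
    have h2 : n k₀ = 2 := by have := h.le_two k₀ hk₀; omega
    rw [← Finset.add_sum_erase K n hk₀, h2]
    have := sum_le_card_of_le_one (K := K.erase k₀) (n := n) fun k hk =>
      h.le_one_of_ne hk₀ h2 (Finset.mem_of_mem_erase hk) (Finset.ne_of_mem_erase hk)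
    rw [Finset.card_erase_of_mem hk₀] at this
    have := Finset.card_pos.2 ⟨k₀, hk₀⟩
    omega

open Classical in
-- As `ε² = 0`, the two coordinates record the states with no double component and with exactly one.
-- One double component leaves one more empty component for the same total, and the factor `x` on
-- the first coordinate makes up for this.
lemma mul_fst_add_snd_prod_stateWeight {κ : Type*} (x : R) (K : Finset κ) (n : κ → ℕ)
    (P : κ → Prop) :
    x * (∏ k ∈ K, stateWeight x (n k) (P k)).fst + (∏ k ∈ K, stateWeight x (n k) (P k)).snd =
      if IsAdmissible K n P then x ^ (K.card + 1 - ∑ k ∈ K, n k) else 0 := by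
  by_cases h1 : ∀ k ∈ K, n k ≤ 1
  · have hadm : IsAdmissible K n P := ⟨fun k hk => (h1 k hk).trans (by norm_num),
      fun k hk h => by have := h1 k hk; omega, fun k hk _ _ h => by have := h1 k hk; omega⟩
    rw [prod_stateWeight_of_le_one x K n P h1, if_pos hadm, fst_inl, snd_inl, add_zero,
      ← pow_succ']
    have := sum_le_card_of_le_one h1
    congr 1
    omega
  · rw [fst_prod_stateWeight, if_neg h1, mul_zero, zero_add]
    split_ifs with hadm
    · push Not at h1
      obtain ⟨k₀, hk₀, hlt⟩ := h1
      have h2 : n k₀ = 2 := by have := hadm.le_two k₀ hk₀; omega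
      rw [← Finset.mul_prod_erase K _ hk₀, prod_stateWeight_of_le_one x _ n P fun k hk =>
        hadm.le_one_of_ne hk₀ h2 (Finset.mem_of_mem_erase hk) (Finset.ne_of_mem_erase hk)]
      have hw : stateWeight x (n k₀) (P k₀) = DualNumber.eps := by
        simp [stateWeight, h2, hadm.prop_of_eq_two k₀ hk₀ h2]
      rw [hw, ← Finset.add_sum_erase K n hk₀, h2, Finset.card_erase_of_mem hk₀]
      have := Finset.card_pos.2 ⟨k₀, hk₀⟩
      simp only [snd_mul, DualNumber.fst_eps, DualNumber.snd_eps, fst_inl, snd_inl, smul_zero,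
        zero_add, MulOpposite.smul_eq_mul_unop, MulOpposite.unop_op, one_mul]
      congr 1
      omega
    · have : ∏ k ∈ K, stateWeight x (n k) (P k) = 0 := by
        by_cases ha : ∀ k ∈ K, n k ≤ 2 ∧ (n k = 2 → P k)
        · have hb : ¬ ∀ k ∈ K, ∀ k' ∈ K, n k = 2 → n k' = 2 → k = k' := fun hb =>
            hadm ⟨fun k hk => (ha k hk).1, fun k hk => (ha k hk).2, hb⟩
          push Not at hb
          obtain ⟨k, hk, k', hk', h2, h2', hne⟩ := hb
          rw [← Finset.mul_prod_erase K _ hk, ← Finset.mul_prod_erase (K.erase k) _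
            (Finset.mem_erase.2 ⟨hne.symm, hk'⟩)]
          have hw : stateWeight x (n k) (P k) = DualNumber.eps := by
            simp [stateWeight, h2, (ha k hk).2 h2]
          have hw' : stateWeight x (n k') (P k') = DualNumber.eps := by
            simp [stateWeight, h2', (ha k' hk').2 h2']
          rw [hw, hw', ← mul_assoc, DualNumber.eps_mul_eps, zero_mul]
        · push Not at ha
          obtain ⟨k, hk, ha⟩ := ha
          refine Finset.prod_eq_zero hk ?_
          unfold stateWeight
          by_cases hk2 : n k ≤ 2
          · have := ha hk2
            simp [this]
          · rw [if_neg (by omega), if_neg (by omega), if_neg (by omega)]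
      rw [this, snd_zero]

open Classical in
lemma sum_stateWeight_card {ι : Type*} (x : R) (N : Multiset ι) (P : Multiset ι → Prop) :
    ∑ T ∈ Finset.Iic N, stateWeight x T.card (P T) =
      inl x + (((Finset.Iic N).filter (fun T => T.card = 1)).card : DualNumber R) +
        (((Finset.Iic N).filter (fun T => T.card = 2 ∧ P T)).card : DualNumber R) *
          DualNumber.eps := by
  have h : ∀ T : Multiset ι, stateWeight x T.card (P T) = (if T = 0 then inl x else 0) +
      (if T.card = 1 then 1 else 0) +
        (if T.card = 2 ∧ P T then (1 : DualNumber R) else 0) * DualNumber.eps := by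
    intro T
    unfold stateWeight
    by_cases h0 : T = 0
    · simp [h0]
    · have h0' : T.card ≠ 0 := fun h => h0 (Multiset.card_eq_zero.1 h)
      by_cases h1 : T.card = 1
      · simp [h0, h1]
      · simp [h0, h0', h1]
  simp only [h, Finset.sum_add_distrib, ← Finset.sum_mul, Finset.sum_boole]
  simp

open Classical in
-- The version for the component of `0̄`, which always carries one mark: it is never empty, so `x`
-- does not occur.
lemma sum_stateWeight_card_add_one {ι : Type*} (x : R) (N : Multiset ι) (P : Multiset ι → Prop) :
    ∑ T ∈ Finset.Iic N, stateWeight x (T.card + 1) (P T) =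
      1 + (((Finset.Iic N).filter (fun T => T.card = 1 ∧ P T)).card : DualNumber R) *
          DualNumber.eps := by
  have h : ∀ T : Multiset ι, stateWeight x (T.card + 1) (P T) = (if T = 0 then 1 else 0) +
        (if T.card = 1 ∧ P T then (1 : DualNumber R) else 0) * DualNumber.eps := by
    intro T
    unfold stateWeight
    by_cases h0 : T = 0 <;> simp [h0]
  simp only [h, Finset.sum_add_distrib, ← Finset.sum_mul, Finset.sum_boole]
  rw [Finset.filter_eq', if_pos (by simp)]
  simp

end Weights

/-! ### Equality of the local sums on a single tree -/

section LocalSums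

open Classical in
-- Multiplicities in `N` are irrelevant here, so passing from `F.val` to `2 • F.val` does not count
-- an edge twice.
lemma card_filter_Iic_card_eq_one {ι : Type*} (N : Multiset ι) (P : Multiset ι → Prop) :
    ((Finset.Iic N).filter (fun T => T.card = 1 ∧ P T)).card = {i | i ∈ N ∧ P {i}}.ncard := by
  rw [← Set.ncard_coe_finset]
  symm
  refine Set.ncard_congr (fun i _ => {i}) ?_ ?_ ?_
  · rintro i ⟨hi, hP⟩
    simp [hi, hP]
  · intro i j _ _ h
    simpa using h
  · intro T hT
    simp only [Finset.coe_filter, Finset.mem_Iic, Set.mem_ofPred_eq] at hT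
    obtain ⟨i, rfl⟩ := Multiset.card_eq_one.1 hT.2.1
    exact ⟨i, ⟨by simpa using hT.1, hT.2.2⟩, rfl⟩

open Classical in
-- Doubling `F` makes room for two roots on the same edge, and a multiset of size at most two needs
-- no more.
lemma le_filter_two_nsmul_iff {ι : Type*} (F : Finset ι) (p : ι → Prop) {T : Multiset ι}
    (hT : T.card ≤ 2) : T ≤ (2 • F.val).filter p ↔ ∀ i ∈ T, i ∈ F ∧ p i := by
  constructor
  · intro h i hi
    have := Multiset.mem_of_le h hi
    simpa using this
  · intro h
    rw [Multiset.le_iff_count]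
    intro i
    by_cases hi : i ∈ T
    · obtain ⟨hF, hp⟩ := h i hi
      rw [Multiset.count_filter_of_pos hp, Multiset.count_nsmul,
        Multiset.count_eq_one_of_mem F.nodup hF]
      exact (Multiset.count_le_card i T).trans (by simpa using hT)
    · rw [Multiset.count_eq_zero_of_notMem hi]
      exact Nat.zero_le _

variable {α : Type u} {β : Type v}

/-- The elements of `C` that are `0̄` or in `T`. -/
def marked (C : Set (Vert α)) (T : Multiset α) : Set (Vert α) := {v ∈ C | v ∈ rooted {a | a ∈ T}}

/-- The set `M` meets both colour classes. -/
def IsBicoloured (A : Set α) (M : Set (Vert α)) : Prop :=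
  (∃ x ∈ M, x ∈ Vert.old '' A) ∧ ∃ x ∈ M, x ∉ Vert.old '' A

variable {H : Graph (Vert α) (Edge α β)} {A B : Set α} {C : Set (Vert α)}

lemma ncard_eq_card_filter_add [DecidablePred fun a => Vert.old a ∈ C]
    [Decidable (Vert.zeroBar ∈ C)] {W : Finset α} (hC : C ⊆ rooted W) :
    C.ncard = (W.val.filter (fun a => Vert.old a ∈ C)).card +
      if Vert.zeroBar ∈ C then 1 else 0 := by
  have hfin : (Vert.old '' (W.filter (fun a => Vert.old a ∈ C) : Set α)).Finite :=
    (Finset.finite_toSet _).image _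
  have h1 : (Vert.old '' (W.filter (fun a => Vert.old a ∈ C) : Set α)).ncard =
      (W.val.filter (fun a => Vert.old a ∈ C)).card := by
    rw [Set.ncard_image_of_injective _ (fun a b h => by simpa using h), Set.ncard_coe_finset]
    rfl
  have h2 : ∀ a, Vert.old a ∈ C → a ∈ W := by
    intro a ha
    simpa [rooted] using hC ha
  rw [← h1]
  split_ifs with h0
  · rw [← Set.ncard_insert_of_notMem (a := Vert.zeroBar) (by simp) hfin]
    congr 1
    ext v
    cases v with
    | zero => simpa using fun h => by simpa [rooted] using hC h
    | zeroBar => simp [h0]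
    | old a => simpa using h2 a
  · rw [add_zero]
    congr 1
    ext v
    cases v with
    | zero => simpa using fun h => by simpa [rooted] using hC h
    | zeroBar => simp [h0]
    | old a => simpa using h2 a

open Classical in
-- Without `0̄` in `C`, both colours must come from `T` itself, so `T` consists of one vertex of
-- each colour.
lemma card_filter_isBicoloured {W : Finset α} (hC : C ⊆ rooted W) (h0 : Vert.zeroBar ∉ C) :
    ((Finset.Iic (W.val.filter (fun a => Vert.old a ∈ C))).filter
      (fun T => T.card = 2 ∧ IsBicoloured A (marked C T))).card =
        (C ∩ Vert.old '' A).ncard * (C \ Vert.old '' A).ncard := by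
  have hold : ∀ v ∈ C, ∃ a ∈ W, Vert.old a = v := by
    intro v hv
    rcases hC hv with rfl | h
    · exact absurd hv h0
    · simpa using h
  rw [← Set.ncard_coe_finset, ← Set.ncard_prod]
  have h1 : ∀ z ∈ (C ∩ Vert.old '' A) ×ˢ (C \ Vert.old '' A), ∃ a b : α, a ∈ W ∧ b ∈ W ∧
      Vert.old a = z.1 ∧ Vert.old b = z.2 := by
    rintro ⟨x, y⟩ ⟨hx, hy⟩
    obtain ⟨a, ha, rfl⟩ := hold x hx.1
    obtain ⟨b, hb, rfl⟩ := hold y hy.1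
    exact ⟨a, b, ha, hb, rfl, rfl⟩
  choose a b ha hb hax hby using h1
  symm
  refine Set.ncard_congr (fun z hz => {a z hz, b z hz}) ?_ ?_ ?_
  · rintro ⟨x, y⟩ hz
    have e1 := hax _ hz
    have e2 := hby _ hz
    have m1 := ha _ hz
    have m2 := hb _ hz
    generalize a (x, y) hz = a' at *
    generalize b (x, y) hz = b' at *
    dsimp only at e1 e2
    subst e1 e2
    have hab : a' ≠ b' := by rintro rfl; exact hz.2.2 hz.1.2
    simp only [Finset.coe_filter, Finset.mem_Iic, Set.mem_ofPred_eq]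
    refine ⟨?_, by simp, ⟨.old a', ⟨hz.1.1, ?_⟩, hz.1.2⟩, .old b', ⟨hz.2.1, ?_⟩, hz.2.2⟩
    · rw [Multiset.le_iff_subset (by simp [hab])]
      intro c hc
      simp only [Multiset.insert_eq_cons, Multiset.mem_cons, Multiset.mem_singleton] at hc
      rcases hc with rfl | rfl
      · simpa [m1] using hz.1.1
      · simpa [m2] using hz.2.1
    · simp [rooted]
    · simp [rooted]
  · rintro ⟨x, y⟩ ⟨x', y'⟩ hz hz' h
    have e1 := hax _ hz
    have e2 := hby _ hz
    have e1' := hax _ hz'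
    have e2' := hby _ hz'
    generalize a (x, y) hz = p at *
    generalize b (x, y) hz = q at *
    generalize a (x', y') hz' = p' at *
    generalize b (x', y') hz' = q' at *
    dsimp only at e1 e2 e1' e2'
    subst e1 e2 e1' e2'
    have hp : p ∈ ({p', q'} : Multiset α) := by rw [← h]; simp
    have hq : q ∈ ({p', q'} : Multiset α) := by rw [← h]; simp
    simp only [Multiset.insert_eq_cons, Multiset.mem_cons, Multiset.mem_singleton] at hp hq
    have hp' : p = p' := by
      rcases hp with h | rfl
      · exact h
      · exact absurd hz.1.2 hz'.2.2
    have hq' : q = q' := by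
      rcases hq with rfl | h
      · exact absurd hz'.1.2 hz.2.2
      · exact h
    rw [hp', hq']
  · intro T hT
    simp only [Finset.coe_filter, Finset.mem_Iic, Set.mem_ofPred_eq] at hT
    obtain ⟨hle, hcard, ⟨x, hx, hxA⟩, y, hy, hyA⟩ := hT
    have hz : (x, y) ∈ (C ∩ Vert.old '' A) ×ˢ (C \ Vert.old '' A) := ⟨⟨hx.1, hxA⟩, hy.1, hyA⟩
    refine ⟨(x, y), hz, ?_⟩
    have e1 := hax _ hz
    have e2 := hby _ hz
    generalize a (x, y) hz = a' at *
    generalize b (x, y) hz = b' at *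
    dsimp only at e1 e2
    subst e1 e2
    have hab : a' ≠ b' := by rintro rfl; exact hyA hxA
    refine Multiset.eq_of_le_of_card_le ?_ (by simp [hcard])
    rw [Multiset.le_iff_subset (by simp [hab])]
    intro c hc
    simp only [Multiset.insert_eq_cons, Multiset.mem_cons, Multiset.mem_singleton] at hc
    rcases hc with rfl | rfl
    · simpa [rooted] using hx.2
    · simpa [rooted] using hy.2

lemma isBicoloured_marked_singleton (h0 : Vert.zeroBar ∈ C) {a : α} (ha : Vert.old a ∈ C) :
    IsBicoloured A (marked C {a}) ↔ a ∈ A := by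
  constructor
  · rintro ⟨⟨x, ⟨-, rfl | ⟨b, hb, rfl⟩⟩, hxA⟩, -⟩
    · simp at hxA
    · have : b = a := by simpa using hb
      subst this
      simpa using hxA
  · intro h
    exact ⟨⟨.old a, ⟨ha, by simp [rooted]⟩, by simpa using h⟩, .zeroBar, ⟨h0, zeroBar_mem_rooted⟩,
      by simp⟩

open Classical in
/-- Marking the vertices of a tree and marking its edges gives the same generating function, up to
a shift. -/
lemma sum_stateWeight_vertices_eq_edges {R : Type*} [CommRing R] (x : R) (hH : IsColoured H A B)
    (hF : IsForest H) (hC : IsComponent H C) {W : Finset α} (hCW : C ⊆ rooted W)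
    {F : Finset (Edge α β)} (hFH : E(H) = F) :
    ∑ T ∈ Finset.Iic (W.val.filter (fun a => Vert.old a ∈ C)),
      stateWeight (x - 1) (T.card + if Vert.zeroBar ∈ C then 1 else 0)
        (IsBicoloured A (marked C T)) =
    ∑ T ∈ Finset.Iic ((2 • F.val).filter (fun e => e ∈ edgesIn H C)),
      stateWeight x (T.card + if Vert.zeroBar ∈ C then 1 else 0) (HasOddRoots H A B C T) := by
  have hfinC : C.Finite := ((W.finite_toSet.image _).insert _).subset hCW
  have hedge : ∀ e, e ∈ edgesIn H C → e ∈ F := by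
    rintro e ⟨y, -, hy⟩
    have := hy.edge_mem
    rw [hFH] at this
    exact_mod_cast this
  have hedges : ∀ e, e ∈ (2 • F.val).filter (fun e => e ∈ edgesIn H C) ↔ e ∈ edgesIn H C := by
    intro e
    simpa using hedge e
  have hverts : ∀ a, a ∈ W.val.filter (fun a => Vert.old a ∈ C) ↔ Vert.old a ∈ C := by
    intro a
    have : Vert.old a ∈ C → a ∈ W := fun h => by simpa [rooted] using hCW h
    simpa using this
  by_cases h0 : Vert.zeroBar ∈ C
  -- Both sides equal `1 + |C ∩ A| ε`.
  · simp only [h0, if_true]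
    rw [sum_stateWeight_card_add_one, sum_stateWeight_card_add_one, card_filter_Iic_card_eq_one,
      card_filter_Iic_card_eq_one]
    simp only [hedges, hverts]
    have e1 := ncard_hasOddRoots_singleton hH hF hC h0
    have e2 : {a | Vert.old a ∈ C ∧ IsBicoloured A (marked C {a})}.ncard =
        (C ∩ Vert.old '' A).ncard := by
      have : {a | Vert.old a ∈ C ∧ IsBicoloured A (marked C {a})} = {a | Vert.old a ∈ C ∧ a ∈ A} := by
        ext a
        exact and_congr_right fun ha => isBicoloured_marked_singleton h0 ha
      rw [this, ← Set.ncard_image_of_injective (f := Vert.old) _ (fun a b h => by simpa using h)]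
      congr 1
      ext v
      constructor
      · rintro ⟨a, ha, rfl⟩
        exact ⟨ha.1, a, ha.2, rfl⟩
      · rintro ⟨hv, a, ha, rfl⟩
        exact ⟨a, ⟨hv, ha⟩, rfl⟩
    rw [e1, e2]
  -- The `ε`-parts agree by the two pair counts. The rest is `(x - 1) + |C|` against `x + (|C| -
  -- 1)`: the shift of the variable is the difference between vertices and edges of a tree.
  · simp only [h0, if_false, add_zero]
    rw [sum_stateWeight_card, sum_stateWeight_card, card_filter_isBicoloured hCW h0]
    have e1 := ncard_hasOddRoots_pair hH hF hC h0
    have e2 : ((Finset.Iic ((2 • F.val).filter (fun e => e ∈ edgesIn H C))).filter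
        (fun T => T.card = 2 ∧ HasOddRoots H A B C T)).card =
          (C ∩ Vert.old '' A).ncard * (C \ Vert.old '' A).ncard := by
      rw [← e1, ← Set.ncard_coe_finset]
      congr 1
      ext T
      simp only [Finset.coe_filter, Finset.mem_Iic, Set.mem_ofPred_eq]
      constructor
      · rintro ⟨hle, hc, ho⟩
        exact ⟨fun e he => (hedges e).1 (Multiset.mem_of_le hle he), hc, ho⟩
      · rintro ⟨hle, hc, ho⟩
        exact ⟨(le_filter_two_nsmul_iff F _ hc.le).2 fun e he => ⟨hedge e (hle e he), hle e he⟩,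
          hc, ho⟩
    have e3 : ((Finset.Iic (W.val.filter (fun a => Vert.old a ∈ C))).filter
        (fun T => T.card = 1)).card = C.ncard := by
      have := card_filter_Iic_card_eq_one (W.val.filter (fun a => Vert.old a ∈ C)) (fun _ => True)
      simp only [and_true] at this
      rw [this]
      simp only [hverts]
      rw [← Set.ncard_image_of_injective (f := Vert.old) _ (fun a b h => by simpa using h)]
      congr 1
      ext v
      constructor
      · rintro ⟨a, ha, rfl⟩
        exact ha
      · intro hv
        rcases hCW hv with rfl | ⟨a, -, rfl⟩
        · exact absurd hv h0
        · exact ⟨a, hv, rfl⟩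
    have e4 : ((Finset.Iic ((2 • F.val).filter (fun e => e ∈ edgesIn H C))).filter
        (fun T => T.card = 1)).card = (edgesIn H C).ncard := by
      have := card_filter_Iic_card_eq_one ((2 • F.val).filter (fun e => e ∈ edgesIn H C))
        (fun _ => True)
      simp only [and_true] at this
      rw [this]
      simp only [hedges, Set.ofPred_mem_eq]
    rw [e2, e3, e4, ← hF.ncard_edgesIn_add_one hC hfinC, TrivSqZeroExt.inl_sub]
    push_cast
    rw [TrivSqZeroExt.inl_one]
    ring

end LocalSums

/-! ### The generating function identity for a fixed forest -/

section ForestIdentity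

variable {α : Type u} {β : Type v} {H : Graph (Vert α) (Edge α β)} {A B : Set α}
  {W : Finset α} {F : Finset (Edge α β)} {K : Finset (Set (Vert α))}

lemma isComponent_reach {x : Vert α} (hx : x ∈ V(H)) : IsComponent H {y | Reach H x y} :=
  ⟨x, hx, rfl⟩

lemma existsUnique_component_of_mem (hK : ∀ C, C ∈ K ↔ IsComponent H C) {x : Vert α}
    (hx : x ∈ V(H)) : ∃! C, C ∈ K ∧ x ∈ C :=
  ⟨_, ⟨(hK _).2 (isComponent_reach hx), .refl hx⟩,
    fun _ hC => ((hK _).1 hC.1).eq_of_mem (isComponent_reach hx) hC.2 (.refl hx)⟩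

lemma existsUnique_component_of_mem_edgeSet (hK : ∀ C, C ∈ K ↔ IsComponent H C) {e : Edge α β}
    (he : e ∈ E(H)) : ∃! C, C ∈ K ∧ e ∈ edgesIn H C := by
  obtain ⟨x, y, hxy⟩ := Graph.exists_isLink_of_mem_edgeSet he
  obtain ⟨C, ⟨hC, hx⟩, huniq⟩ := existsUnique_component_of_mem hK hxy.left_mem
  refine ⟨C, ⟨hC, x, hx, y, hxy⟩, ?_⟩
  rintro C' ⟨hC', z, hz, w, hzw⟩
  refine huniq C' ⟨hC', ?_⟩
  rcases hxy.left_eq_or_eq hzw with rfl | rfl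
  · exact hz
  · exact ((hK _).1 hC').mem_of_reach hz (.of_isLink hzw)

open Classical in
/-- The number of elements of `C` that are `0̄` or in `S`. -/
noncomputable def markCount (S : Multiset α) (C : Set (Vert α)) : ℕ :=
  (S.filter (fun a => Vert.old a ∈ C)).card + if Vert.zeroBar ∈ C then 1 else 0

open Classical in
/-- The number of edge roots in `C`, plus one if `0̄` is in `C`. -/
noncomputable def rootCount (H : Graph (Vert α) (Edge α β)) (R : Multiset (Edge α β))
    (C : Set (Vert α)) : ℕ :=
  (R.filter (fun e => e ∈ edgesIn H C)).card + if Vert.zeroBar ∈ C then 1 else 0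

open Classical in
/-- The multiset `R` of edge roots on the edges of a forest satisfies the conditions of a partially
2-edge-rooted forest. -/
def IsRooting (H : Graph (Vert α) (Edge α β)) (A B : Set α) (K : Finset (Set (Vert α)))
    (R : Multiset (Edge α β)) : Prop :=
  IsAdmissible K (rootCount H R)
    (fun C => HasOddRoots H A B C (R.filter (fun e => e ∈ edgesIn H C)))

lemma sum_zeroBar_mem [∀ C : Set (Vert α), Decidable (Vert.zeroBar ∈ C)]
    (hK : ∀ C, C ∈ K ↔ IsComponent H C) (hV : V(H) = rooted W) :
    ∑ C ∈ K, (if Vert.zeroBar ∈ C then 1 else 0) = 1 := by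
  classical
  obtain ⟨C, ⟨hC, h0⟩, huniq⟩ := existsUnique_component_of_mem hK
    (x := Vert.zeroBar) (by rw [hV]; exact zeroBar_mem_rooted)
  rw [Finset.sum_eq_single_of_mem C hC fun C' hC' hne => if_neg fun h => hne (huniq C' ⟨hC', h⟩),
    if_pos h0]

lemma sum_markCount (hK : ∀ C, C ∈ K ↔ IsComponent H C) (hV : V(H) = rooted W) {S : Multiset α}
    (hS : S ≤ W.val) : ∑ C ∈ K, markCount S C = S.card + 1 := by
  classical
  simp only [markCount]
  rw [Finset.sum_add_distrib, sum_zeroBar_mem hK hV,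
    sum_card_filter K (fun C a => Vert.old a ∈ C) S fun a ha =>
      existsUnique_component_of_mem hK (by
        rw [hV]
        exact old_mem_rooted.2 (Multiset.mem_of_le hS ha))]

lemma sum_rootCount (hK : ∀ C, C ∈ K ↔ IsComponent H C) (hV : V(H) = rooted W) (hE : E(H) = F)
    {R : Multiset (Edge α β)} (hR : ∀ e ∈ R, e ∈ F) :
    ∑ C ∈ K, rootCount H R C = R.card + 1 := by
  classical
  simp only [rootCount]
  rw [Finset.sum_add_distrib, sum_zeroBar_mem hK hV,
    sum_card_filter K (fun C e => e ∈ edgesIn H C) R fun e he =>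
      existsUnique_component_of_mem_edgeSet hK (by
        rw [hE]
        exact hR e he)]

lemma ncard_edgesIn_eq_card {C : Set (Vert α)} [DecidablePred fun e => e ∈ edgesIn H C]
    (hE : E(H) = F) :
    (edgesIn H C).ncard = (F.val.filter (fun e => e ∈ edgesIn H C)).card := by
  change _ = (F.filter (fun e => e ∈ edgesIn H C)).card
  rw [← Set.ncard_coe_finset]
  congr 1
  ext e
  simp only [Finset.coe_filter, Set.mem_ofPred_eq]
  refine ⟨fun h => ⟨?_, h⟩, fun h => h.2⟩
  obtain ⟨x, -, hx⟩ := h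
  have := hx.edge_mem
  rw [hE] at this
  exact this

/-- Each tree has one more vertex than edges, and there are `W.card + 1` vertices because of `0̄`.
This converts codimensions of faces into numbers of components. -/
lemma card_components_add_card (hF : IsForest H) (hK : ∀ C, C ∈ K ↔ IsComponent H C)
    (hV : V(H) = rooted W) (hE : E(H) = F) : K.card + F.card = W.card + 1 := by
  classical
  have h1 : ∀ C ∈ K, (F.val.filter (fun e => e ∈ edgesIn H C)).card + 1 = markCount W.val C := by
    intro C hC
    have hCW : C ⊆ rooted W := hV ▸ ((hK C).1 hC).subset
    rw [← ncard_edgesIn_eq_card hE, hF.ncard_edgesIn_add_one ((hK C).1 hC)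
      (((W.finite_toSet.image _).insert _).subset hCW)]
    exact ncard_eq_card_filter_add hCW
  have h2 := Finset.sum_congr rfl h1
  rw [sum_markCount hK hV le_rfl, Finset.sum_add_distrib,
    sum_card_filter K (fun C e => e ∈ edgesIn H C) F.val fun e he =>
      existsUnique_component_of_mem_edgeSet hK (by rw [hE]; exact he)] at h2
  simp at h2
  omega

lemma marked_filter {C : Set (Vert α)} [DecidablePred fun a => Vert.old a ∈ C]
    (S : Multiset α) : marked C (S.filter (fun a => Vert.old a ∈ C)) = marked C S := by
  ext v
  refine and_congr_right fun hv => ?_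
  cases v with
  | zero => simp [rooted]
  | zeroBar => simp [rooted]
  | old a => simp [rooted, hv]

open Classical in
/-- For a fixed forest `H` of the reduced graph with edge set `F`, the faces of the biconing that
extend `F` and the rootings of `F` have the same generating function, up to a shift. -/
lemma sum_faces_eq_sum_rootings {R : Type*} [CommRing R] (x : R) (hH : IsColoured H A B)
    (hF : IsForest H) (hK : ∀ C, C ∈ K ↔ IsComponent H C) (hV : V(H) = rooted W)
    (hE : E(H) = F) :
    ∑ S ∈ Finset.Iic W.val,
      ((if IsAdmissible K (markCount S) (fun C => IsBicoloured A (marked C S)) then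
          (x - 1) ^ (W.card + 1 - (F.card + S.card)) else 0) +
        if ∀ C ∈ K, markCount S C ≤ 1 then (x - 1) ^ (W.card + 1 - (F.card + S.card + 1)) else 0) =
      ∑ Q ∈ Finset.Iic (2 • F.val),
        if IsRooting H A B K Q then x ^ (W.card + 1 - (F.card + Q.card)) else 0 := by
  have hcard := card_components_add_card hF hK hV hE
  -- Both sums factor over the components, and the factors agree one by one.
  have key : ∑ S ∈ Finset.Iic W.val,
      ∏ C ∈ K, stateWeight (x - 1) (markCount S C) (IsBicoloured A (marked C S)) =
      ∑ Q ∈ Finset.Iic (2 • F.val), ∏ C ∈ K, stateWeight x (rootCount H Q C)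
        (HasOddRoots H A B C (Q.filter (fun e => e ∈ edgesIn H C))) := by
    have h1 := sum_Iic_prod_filter K (fun C a => Vert.old a ∈ C) W.val
      (fun a ha => existsUnique_component_of_mem hK (by rw [hV]; exact old_mem_rooted.2 ha))
      (fun C T => stateWeight (x - 1) (T.card + if Vert.zeroBar ∈ C then 1 else 0)
        (IsBicoloured A (marked C T)))
    have h2 := sum_Iic_prod_filter K (fun C e => e ∈ edgesIn H C) (2 • F.val)
      (fun e he => existsUnique_component_of_mem_edgeSet hK (by
        rw [hE]
        simpa using he))
      (fun C T => stateWeight x (T.card + if Vert.zeroBar ∈ C then 1 else 0)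
        (HasOddRoots H A B C T))
    simp only [marked_filter] at h1
    simp only [markCount, rootCount]
    rw [h1, h2]
    exact Finset.prod_congr rfl fun C hC => sum_stateWeight_vertices_eq_edges x hH hF
      ((hK C).1 hC) (hV ▸ ((hK C).1 hC).subset) hE
  have e1 := congrArg (fun z : DualNumber R => x * z.fst + z.snd) key
  simp only [TrivSqZeroExt.fst_sum, TrivSqZeroExt.snd_sum, Finset.mul_sum,
    ← Finset.sum_add_distrib, mul_fst_add_snd_prod_stateWeight] at e1
  -- On the left the weights are taken at `x - 1`, so the expression is split: the bracket gives the
  -- faces without `00̄`, and the extra first coordinate gives those with it.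
  have e2 : ∀ z : DualNumber R, x * z.fst + z.snd = ((x - 1) * z.fst + z.snd) + z.fst :=
    fun z => by ring
  simp only [e2] at e1
  simp only [mul_fst_add_snd_prod_stateWeight] at e1
  simp only [fst_prod_stateWeight] at e1
  refine Eq.trans ?_ (e1.trans ?_)
  · refine Finset.sum_congr rfl fun S hS => ?_
    rw [sum_markCount hK hV (Finset.mem_Iic.1 hS)]
    rw [show W.card + 1 - (F.card + S.card) = K.card + 1 - (S.card + 1) by omega,
      show W.card + 1 - (F.card + S.card + 1) = K.card - (S.card + 1) by omega]
  · refine Finset.sum_congr rfl fun Q hQ => ?_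
    rw [sum_rootCount hK hV hE fun e he => by
      simpa using Multiset.mem_of_le (Finset.mem_Iic.1 hQ) he]
    unfold IsRooting
    congr 2
    omega

lemma ncard_marked {C : Set (Vert α)} {S : Finset α} :
    (marked C S.val).ncard = markCount S.val C := by
  classical
  have h : marked C S.val ⊆ rooted S := fun v hv => hv.2
  have := ncard_eq_card_filter_add h
  have h1 : S.val.filter (fun a => Vert.old a ∈ marked C S.val) =
      S.val.filter (fun a => Vert.old a ∈ C) :=
    Multiset.filter_congr fun a ha => ⟨fun h => h.1, fun h => ⟨h, old_mem_rooted.2 ha⟩⟩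
  have h2 : Vert.zeroBar ∈ marked C S.val ↔ Vert.zeroBar ∈ C :=
    ⟨fun h => h.1, fun h => ⟨h, zeroBar_mem_rooted⟩⟩
  rw [this, markCount, h1]
  simp only [h2]

lemma finite_marked {C : Set (Vert α)} {S : Finset α} : (marked C S.val).Finite :=
  ((S.finite_toSet.image _).insert _).subset fun _ hv => hv.2

lemma markCount_le_one_iff (hK : ∀ C, C ∈ K ↔ IsComponent H C)
    {S : Finset α} :
    (∀ C ∈ K, markCount S.val C ≤ 1) ↔ ∀ x ∈ rooted S, ∀ y ∈ rooted S, Reach H x y → x = y := by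
  classical
  simp only [← ncard_marked, Set.ncard_le_one finite_marked]
  constructor
  · intro h x hx y hy hr
    exact h _ ((hK _).2 (isComponent_reach hr.left_mem)) x ⟨.refl hr.left_mem, hx⟩ y ⟨hr, hy⟩
  · intro h C hC x hx y hy
    exact h x hx.2 y hy.2 (((hK C).1 hC).reach hx.1 hy.1)

lemma isAdmissible_markCount_iff (hK : ∀ C, C ∈ K ↔ IsComponent H C)
    {S : Finset α} :
    IsAdmissible K (markCount S.val) (fun C => IsBicoloured A (marked C S.val)) ↔
      IsNearTransversal H A (rooted S) := by
  classical
  constructor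
  · intro h
    have two : ∀ C ∈ K, ∀ x ∈ marked C S.val, ∀ y ∈ marked C S.val, x ≠ y →
        markCount S.val C = 2 := by
      intro C hC x hx y hy hne
      refine le_antisymm (h.le_two C hC) ?_
      rw [← ncard_marked, ← Set.ncard_pair hne]
      exact Set.ncard_le_ncard (Set.insert_subset hx (Set.singleton_subset_iff.2 hy)) finite_marked
    constructor
    · intro x hx y hy hc hr
      by_contra hne
      have hC := (hK _).2 (isComponent_reach hr.left_mem)
      have hxm : x ∈ marked {y | Reach H x y} S.val := ⟨.refl hr.left_mem, hx⟩
      have hym : y ∈ marked {y | Reach H x y} S.val := ⟨hr, hy⟩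
      have h2 := two _ hC x hxm y hym hne
      -- The two vertices are the only marked ones of their component, so its two colours must be
      -- theirs.
      have heq : {x, y} = marked {y | Reach H x y} S.val := by
        refine Set.eq_of_subset_of_ncard_le
          (Set.insert_subset hxm (Set.singleton_subset_iff.2 hym)) ?_ finite_marked
        rw [ncard_marked, h2, Set.ncard_pair hne]
      obtain ⟨⟨u, hu, huA⟩, w, hw, hwA⟩ := h.prop_of_eq_two _ hC h2
      rw [← heq] at hu hw
      rcases hu with rfl | rfl <;> rcases hw with rfl | rfl <;> tauto
    · intro x hx y hy x' hx' y' hy' hne hne' hr hr'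
      have hC := (hK _).2 (isComponent_reach hr.left_mem)
      have hC' := (hK _).2 (isComponent_reach hr'.left_mem)
      have := h.eq_of_eq_two _ hC _ hC'
        (two _ hC x ⟨.refl hr.left_mem, hx⟩ y ⟨hr, hy⟩ hne)
        (two _ hC' x' ⟨.refl hr'.left_mem, hx'⟩ y' ⟨hr', hy'⟩ hne')
      have hx'' : x' ∈ {y | Reach H x y} := by rw [this]; exact Reach.refl hr'.left_mem
      exact hx''
  · intro h
    have exists_two : ∀ C ∈ K, markCount S.val C = 2 → ∃ x ∈ marked C S.val,
        ∃ y ∈ marked C S.val, x ≠ y := by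
      intro C hC h2
      rw [← ncard_marked, Set.ncard_eq_two] at h2
      obtain ⟨x, y, hne, heq⟩ := h2
      exact ⟨x, by simp [heq], y, by simp [heq], hne⟩
    constructor
    · intro C hC
      rw [← ncard_marked]
      by_contra hlt
      have h2 : 2 < (marked C S.val).ncard := by omega
      rw [Set.two_lt_ncard_iff finite_marked] at h2
      -- Of three marked vertices in one component, two would share a colour.
      obtain ⟨x, y, z, hx, hy, hz, hxy, hxz, hyz⟩ := h2
      have r : ∀ u ∈ marked C S.val, ∀ w ∈ marked C S.val, u ≠ w →
          ¬ (u ∈ Vert.old '' A ↔ w ∈ Vert.old '' A) := fun u hu w hw hne hc =>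
        hne (h.eq_of_colour_eq u hu.2 w hw.2 hc (((hK C).1 hC).reach hu.1 hw.1))
      have r1 := r x hx y hy hxy
      have r2 := r x hx z hz hxz
      have r3 := r y hy z hz hyz
      tauto
    · intro C hC h2
      obtain ⟨x, hx, y, hy, hne⟩ := exists_two C hC h2
      have hc : ¬ (x ∈ Vert.old '' A ↔ y ∈ Vert.old '' A) := fun hc =>
        hne (h.eq_of_colour_eq x hx.2 y hy.2 hc (((hK C).1 hC).reach hx.1 hy.1))
      by_cases hxA : x ∈ Vert.old '' A
      · exact ⟨⟨x, hx, hxA⟩, y, hy, by tauto⟩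
      · exact ⟨⟨y, hy, by tauto⟩, x, hx, hxA⟩
    · intro C hC C' hC' h2 h2'
      obtain ⟨x, hx, y, hy, hne⟩ := exists_two C hC h2
      obtain ⟨x', hx', y', hy', hne'⟩ := exists_two C' hC' h2'
      have hr := h.reach_of_ne x hx.2 y hy.2 x' hx'.2 y' hy'.2 hne hne'
        (((hK C).1 hC).reach hx.1 hy.1) (((hK C').1 hC').reach hx'.1 hy'.1)
      exact ((hK C).1 hC).eq_of_mem ((hK C').1 hC') (((hK C).1 hC).mem_of_reach hx.1 hr) hx'.1

end ForestIdentity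

/-! ### The `h`-polynomial as a sum over faces -/

section HPolynomial

variable {β : Type v}

lemma hPoly_eq_sum {Δ : Set (Finset β)} (hΔ : Δ.Finite) :
    hPoly Δ = ∑ I ∈ hΔ.toFinset, (Polynomial.X - 1 : Polynomial ℤ) ^ (faceRank Δ - I.card) := by
  classical
  have hle : ∀ I ∈ hΔ.toFinset, I.card ∈ Finset.range (faceRank Δ + 1) := by
    intro I hI
    rw [Finset.mem_range, Nat.lt_succ_iff]
    exact le_csSup (hΔ.image _).bddAbove ⟨I, by simpa using hI, rfl⟩
  rw [← Finset.sum_fiberwise_of_maps_to hle]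
  refine Finset.sum_congr rfl fun i _ => ?_
  rw [Finset.sum_congr rfl fun I hI => by rw [(Finset.mem_filter.1 hI).2], Finset.sum_const,
    nsmul_eq_mul, fVec, ← Set.ncard_coe_finset]
  congr 3
  ext I
  simp

lemma sum_Iic_val {ι M : Type*} [AddCommMonoid M] [DecidableEq ι] (W : Finset ι)
    (f : Multiset ι → M) : ∑ T ∈ Finset.Iic W.val, f T = ∑ S ∈ W.powerset, f S.val := by
  symm
  refine Finset.sum_bij (fun S _ => S.val) ?_ ?_ ?_ ?_
  · intro S hS
    rw [Finset.mem_Iic]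
    exact Finset.val_le_iff.2 (Finset.mem_powerset.1 hS)
  · intro S _ T _ h
    exact Finset.val_injective h
  · intro T hT
    rw [Finset.mem_Iic] at hT
    exact ⟨⟨T, Multiset.nodup_of_le hT W.nodup⟩, Finset.mem_powerset.2 (Finset.val_le_iff.1 hT),
      rfl⟩
  · intro S _
    rfl

end HPolynomial

/-! ### Faces of the biconing over a fixed forest -/

section Biconing

variable {α : Type u} {β : Type v} {G : Graph α β} {A B : Set α} {hAB : V(G) = A ∪ B}

lemma isColoured_reduced (hAB : V(G) = A ∪ B) (F : Set (Edge α β)) :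
    IsColoured ((reduced G A B hAB).restrict F) A B := by
  intro v hv hvA
  rw [Graph.vertexSet_restrict, vertexSet_reduced, hAB] at hv
  rcases hv with rfl | ⟨a, ha, rfl⟩
  · exact Or.inr rfl
  · have haA : a ∉ A := fun h => hvA ⟨a, h, rfl⟩
    exact Or.inl ⟨a, ⟨ha.resolve_left haA, haA⟩, rfl⟩

lemma finite_edgeSet_biconing (hV : V(G).Finite) (hE : E(G).Finite) :
    E(biconing G A B hAB).Finite := by
  refine ((((hV.image Edge.zeroTo).union (hV.image Edge.zeroBarTo)).union
    (hE.image Edge.old)).insert Edge.cone).subset ?_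
  intro e he
  obtain ⟨x, y, h⟩ := Graph.exists_isLink_of_mem_edgeSet he
  rw [biconing_isLink] at h
  cases e with
  | cone => exact Or.inl rfl
  | zeroTo a => exact Or.inr (Or.inl (Or.inl ⟨a, hAB ▸ Or.inl h.1, rfl⟩))
  | zeroBarTo b => exact Or.inr (Or.inl (Or.inr ⟨b, hAB ▸ Or.inr h.1, rfl⟩))
  | old e =>
    obtain ⟨u, v, huv, -⟩ := h
    exact Or.inr (Or.inr ⟨e, huv.edge_mem, rfl⟩)

lemma finite_graphicComplex (hV : V(G).Finite) (hE : E(G).Finite) :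
    (graphicComplex (biconing G A B hAB)).Finite := by
  have hfin := finite_edgeSet_biconing (hAB := hAB) hV hE
  refine (hfin.toFinset.powerset.finite_toSet).subset ?_
  intro I hI
  simpa [Finset.subset_iff, Set.subset_def] using hI.1

lemma finite_isComponent {H : Graph (Vert α) (Edge α β)} {W : Finset α} (hV : V(H) = rooted W) :
    {C | IsComponent H C}.Finite := by
  have : (rooted (W : Set α)).Finite := (W.finite_toSet.image _).insert _
  exact this.finite_subsets.subset fun C hC => hV ▸ hC.subset

/-- The vertex sets of the components of a graph. -/
noncomputable def components (H : Graph (Vert α) (Edge α β)) (W : Finset α)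
    (hV : V(H) = rooted W) : Finset (Set (Vert α)) := (finite_isComponent hV).toFinset

lemma mem_components {H : Graph (Vert α) (Edge α β)} {W : Finset α} {hV : V(H) = rooted W}
    {C : Set (Vert α)} : C ∈ components H W hV ↔ IsComponent H C := by
  simp [components]

open Classical in
/-- The union of `F` and the edges of the base tree joining the elements of `S` to `0` or `0̄`. -/
noncomputable def face (A : Set α) (F : Finset (Edge α β)) (S : Finset α) : Finset (Edge α β) :=
  F ∪ S.image (treeEdge A)

lemma coe_face {F : Finset (Edge α β)} {S : Finset α} :
    (face A F S : Set (Edge α β)) = (F : Set (Edge α β)) ∪ treeEdge A '' S := by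
  classical
  simp [face]

lemma mem_face {F : Finset (Edge α β)} {S : Finset α} {e : Edge α β} :
    e ∈ face A F S ↔ e ∈ F ∨ ∃ a ∈ S, treeEdge A a = e := by
  classical
  simp [face]

lemma card_face (hAB : V(G) = A ∪ B) {F : Finset (Edge α β)} {S : Finset α}
    (hF : (F : Set (Edge α β)) ⊆ E(reduced G A B hAB)) (hS : (S : Set α) ⊆ V(G)) :
    (face A F S).card = F.card + S.card := by
  classical
  rw [face, Finset.card_union_of_disjoint, Finset.card_image_of_injective _ treeEdge_injective]
  rw [Finset.disjoint_left]
  intro e he heS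
  obtain ⟨a, ha, rfl⟩ := Finset.mem_image.1 heS
  exact (mem_edgeSet_reduced.1 (hF he)).2 (treeEdge_mem_baseTree hAB (hS ha))

lemma cone_notMem_face {F : Finset (Edge α β)} {S : Finset α}
    (hF : (F : Set (Edge α β)) ⊆ E(reduced G A B hAB)) : Edge.cone ∉ face A F S := by
  rw [mem_face]
  rintro (h | ⟨a, -, h⟩)
  · exact (mem_edgeSet_reduced.1 (hF h)).2 (by simp [baseTree])
  · unfold treeEdge at h
    split_ifs at h

lemma treeEdge_mem_face_iff {F : Finset (Edge α β)} {S : Finset α} {a : α}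
    (hF : (F : Set (Edge α β)) ⊆ E(reduced G A B hAB)) (ha : a ∈ V(G)) :
    treeEdge A a ∈ face A F S ↔ a ∈ S := by
  rw [mem_face]
  constructor
  · rintro (h | ⟨b, hb, h⟩)
    · exact absurd (treeEdge_mem_baseTree hAB ha) (mem_edgeSet_reduced.1 (hF h)).2
    · exact treeEdge_injective h ▸ hb
  · exact fun h => Or.inr ⟨a, h, rfl⟩

lemma face_subset_edgeSet {F : Finset (Edge α β)} {S : Finset α}
    (hF : (F : Set (Edge α β)) ⊆ E(reduced G A B hAB)) (hS : (S : Set α) ⊆ V(G)) :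
    (face A F S : Set (Edge α β)) ⊆ E(biconing G A B hAB) := by
  rw [coe_face]
  rintro e (h | ⟨a, ha, rfl⟩)
  · exact (mem_edgeSet_reduced.1 (hF h)).1
  · exact (isLink_treeEdge hAB (hS ha)).edge_mem

open Classical in
lemma filter_face {F : Finset (Edge α β)} {S : Finset α}
    (hF : (F : Set (Edge α β)) ⊆ E(reduced G A B hAB)) (hS : (S : Set α) ⊆ V(G)) :
    (face A F S).filter (fun e => e ∉ (baseTree A B : Set (Edge α β))) = F := by
  ext e
  rw [Finset.mem_filter, mem_face]
  constructor
  · rintro ⟨h | ⟨a, ha, rfl⟩, he⟩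
    · exact h
    · exact absurd (treeEdge_mem_baseTree hAB (hS ha)) he
  · exact fun h => ⟨Or.inl h, (mem_edgeSet_reduced.1 (hF h)).2⟩

open Classical in
lemma eq_face (hAB : V(G) = A ∪ B) {I : Finset (Edge α β)} {W : Finset α} (hW : (W : Set α) = V(G))
    (hI : Edge.cone ∉ I) :
    face A (I.filter (fun e => e ∉ (baseTree A B : Set (Edge α β))))
      (W.filter (fun a => treeEdge A a ∈ I)) = I := by
  ext e
  rw [mem_face, Finset.mem_filter]
  constructor
  · rintro (h | ⟨a, ha, rfl⟩)
    · exact h.1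
    · exact (Finset.mem_filter.1 ha).2
  · intro he
    by_cases hb : e ∈ (baseTree A B : Set (Edge α β))
    · rcases (mem_baseTree_iff hAB).1 hb with rfl | ⟨a, ha, rfl⟩
      · exact absurd he hI
      · rw [← hW] at ha
        exact Or.inr ⟨a, Finset.mem_filter.2 ⟨ha, he⟩, rfl⟩
    · exact Or.inl ⟨he, hb⟩

lemma treeEdge_ne_cone {a : α} : (treeEdge A a : Edge α β) ≠ .cone := by
  unfold treeEdge
  split_ifs <;> simp

open Classical in
lemma eq_insert_cone_face (hAB : V(G) = A ∪ B) {I : Finset (Edge α β)} {W : Finset α}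
    (hW : (W : Set α) = V(G)) (hI : Edge.cone ∈ I) :
    insert .cone (face A (I.filter (fun e => e ∉ (baseTree A B : Set (Edge α β))))
      (W.filter (fun a => treeEdge A a ∈ I))) = I := by
  have h := eq_face hAB hW (Finset.notMem_erase Edge.cone I)
  have h1 : (I.erase .cone).filter (fun e => e ∉ (baseTree A B : Set (Edge α β))) =
      I.filter (fun e => e ∉ (baseTree A B : Set (Edge α β))) := by
    ext e
    simp only [Finset.mem_filter, Finset.mem_erase]
    refine ⟨fun h => ⟨h.1.2, h.2⟩, fun h => ⟨⟨?_, h.1⟩, h.2⟩⟩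
    rintro rfl
    exact h.2 (by simp [baseTree])
  have h2 : W.filter (fun a => treeEdge A a ∈ I.erase .cone) =
      W.filter (fun a => treeEdge A a ∈ I) :=
    Finset.filter_congr fun a _ => by simp [treeEdge_ne_cone]
  rw [h1, h2] at h
  rw [h, Finset.insert_erase hI]

section FixedForest

variable {W : Finset α} {F : Finset (Edge α β)} {S : Finset α} {K : Finset (Set (Vert α))}

lemma face_mem_graphicComplex_iff (hW : (W : Set α) = V(G))
    (hF : (F : Set (Edge α β)) ⊆ E(reduced G A B hAB)) (hS : S ⊆ W)
    (hf : IsForest ((reduced G A B hAB).restrict F))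
    (hK : ∀ C, C ∈ K ↔ IsComponent ((reduced G A B hAB).restrict F) C) :
    face A F S ∈ graphicComplex (biconing G A B hAB) ↔
      IsAdmissible K (markCount S.val) (fun C => IsBicoloured A (marked C S.val)) := by
  have hS' : (S : Set α) ⊆ V(G) := hW ▸ Finset.coe_subset.2 hS
  rw [isAdmissible_markCount_iff hK]
  change _ ∧ _ ↔ _
  rw [coe_face, isForest_biconing_iff hF hS' S.finite_toSet, ← coe_face]
  exact ⟨fun h => h.2.2, fun h => ⟨face_subset_edgeSet hF hS', hf, h⟩⟩

lemma insert_cone_face_mem_graphicComplex_iff [DecidableEq (Edge α β)] (hW : (W : Set α) = V(G))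
    (hF : (F : Set (Edge α β)) ⊆ E(reduced G A B hAB)) (hS : S ⊆ W)
    (hf : IsForest ((reduced G A B hAB).restrict F))
    (hK : ∀ C, C ∈ K ↔ IsComponent ((reduced G A B hAB).restrict F) C) :
    insert .cone (face A F S) ∈ graphicComplex (biconing G A B hAB) ↔
      ∀ C ∈ K, markCount S.val C ≤ 1 := by
  have hS' : (S : Set α) ⊆ V(G) := hW ▸ Finset.coe_subset.2 hS
  rw [markCount_le_one_iff hK]
  change _ ∧ _ ↔ _
  rw [Finset.coe_insert, coe_face, isForest_biconing_insert_cone_iff hF hS' S.finite_toSet,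
    ← coe_face]
  exact ⟨fun h => h.2.2, fun h => ⟨Set.insert_subset isLink_cone.edge_mem
    (face_subset_edgeSet hF hS'), hf, h⟩⟩

open Classical in
lemma filter_subset_reduced {I : Finset (Edge α β)}
    (hI : (I : Set (Edge α β)) ⊆ E(biconing G A B hAB)) :
    ((I.filter (fun e => e ∉ (baseTree A B : Set (Edge α β))) : Finset (Edge α β)) :
      Set (Edge α β)) ⊆ E(reduced G A B hAB) := by
  intro e he
  obtain ⟨h1, h2⟩ := Finset.mem_filter.1 (Finset.mem_coe.1 he)
  exact mem_edgeSet_reduced.2 ⟨hI h1, h2⟩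

open Classical in
lemma isForest_filter {I : Finset (Edge α β)} (hI : I ∈ graphicComplex (biconing G A B hAB)) :
    IsForest ((reduced G A B hAB).restrict
      (I.filter (fun e => e ∉ (baseTree A B : Set (Edge α β))) : Finset (Edge α β))) :=
  isForest_reduced_of_biconing (filter_subset_reduced hI.1)
    (fun _ he => (Finset.mem_filter.1 (Finset.mem_coe.1 he)).1) hI.2

open Classical in
/-- The faces extending a fixed forest `F` of the reduced graph. -/
lemma sum_faces_extending {M : Type*} [AddCommMonoid M] (hW : (W : Set α) = V(G))
    (hΔ : (graphicComplex (biconing G A B hAB)).Finite)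
    (hF : (F : Set (Edge α β)) ⊆ E(reduced G A B hAB))
    (hf : IsForest ((reduced G A B hAB).restrict F))
    (hK : ∀ C, C ∈ K ↔ IsComponent ((reduced G A B hAB).restrict F) C) (g : ℕ → M) :
    ∑ I ∈ hΔ.toFinset.filter
        (fun I => I.filter (fun e => e ∉ (baseTree A B : Set (Edge α β))) = F), g I.card =
      ∑ S ∈ Finset.Iic W.val,
        ((if IsAdmissible K (markCount S) (fun C => IsBicoloured A (marked C S)) then
          g (F.card + S.card) else 0) +
        if ∀ C ∈ K, markCount S C ≤ 1 then g (F.card + S.card + 1) else 0) := by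
  have hcone : Edge.cone ∈ (baseTree A B : Set (Edge α β)) := by simp [baseTree]
  have hWV : ∀ {S : Finset α}, S ⊆ W → (S : Set α) ⊆ V(G) :=
    fun h => hW ▸ Finset.coe_subset.2 h
  -- Faces with `00̄` are matched with the second summand and faces without it with the first. In
  -- both cases `S` is recovered as the set of vertices whose tree edge is in the face.
  rw [sum_Iic_val, Finset.sum_add_distrib, ← Finset.sum_filter, ← Finset.sum_filter, add_comm,
    ← Finset.sum_filter_add_sum_filter_not _ (fun I => Edge.cone ∈ I)]
  congr 1
  · refine Finset.sum_bij' (fun I _ => W.filter (fun a => treeEdge A a ∈ I))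
      (fun S _ => insert .cone (face A F S)) ?_ ?_ ?_ ?_ ?_
    all_goals simp only [Finset.mem_filter, Finset.mem_powerset, Set.Finite.mem_toFinset, and_imp]
    · intro I hI hIF h0
      refine ⟨Finset.filter_subset _ _, ?_⟩
      rw [← insert_cone_face_mem_graphicComplex_iff hW hF (Finset.filter_subset _ _) hf hK]
      rw [← hIF, eq_insert_cone_face hAB hW h0]
      exact hI
    · intro S hS h
      refine ⟨⟨(insert_cone_face_mem_graphicComplex_iff hW hF hS hf hK).2 h, ?_⟩,
        Finset.mem_insert_self _ _⟩
      rw [Finset.filter_insert, if_neg (not_not_intro hcone)]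
      exact filter_face hF (hWV hS)
    · intro I hI hIF h0
      rw [← hIF, eq_insert_cone_face hAB hW h0]
    · intro S hS h
      ext a
      rw [Finset.mem_filter, Finset.mem_insert, or_iff_right treeEdge_ne_cone]
      exact ⟨fun h => (treeEdge_mem_face_iff hF (hWV subset_rfl h.1)).1 h.2,
        fun h => ⟨hS h, (treeEdge_mem_face_iff hF (hWV hS h)).2 h⟩⟩
    · intro I hI hIF h0
      have hc := card_face hAB hF (S := W.filter (fun a => treeEdge A a ∈ I))
        (hWV (Finset.filter_subset _ _))
      rw [Finset.card_val, ← hc, ← Finset.card_insert_of_notMem (cone_notMem_face hF), ← hIF,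
        eq_insert_cone_face hAB hW h0]
  · refine Finset.sum_bij' (fun I _ => W.filter (fun a => treeEdge A a ∈ I))
      (fun S _ => face A F S) ?_ ?_ ?_ ?_ ?_
    all_goals simp only [Finset.mem_filter, Finset.mem_powerset, Set.Finite.mem_toFinset, and_imp]
    · intro I hI hIF h0
      refine ⟨Finset.filter_subset _ _, ?_⟩
      rw [← face_mem_graphicComplex_iff hW hF (Finset.filter_subset _ _) hf hK, ← hIF,
        eq_face hAB hW h0]
      exact hI
    · intro S hS h
      exact ⟨⟨(face_mem_graphicComplex_iff hW hF hS hf hK).2 h, filter_face hF (hWV hS)⟩,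
        cone_notMem_face hF⟩
    · intro I hI hIF h0
      rw [← hIF, eq_face hAB hW h0]
    · intro S hS h
      ext a
      rw [Finset.mem_filter]
      exact ⟨fun h => (treeEdge_mem_face_iff hF (hWV subset_rfl h.1)).1 h.2,
        fun h => ⟨hS h, (treeEdge_mem_face_iff hF (hWV hS h)).2 h⟩⟩
    · intro I hI hIF h0
      have hc := card_face hAB hF (S := W.filter (fun a => treeEdge A a ∈ I))
        (hWV (Finset.filter_subset _ _))
      rw [Finset.card_val, ← hc, ← hIF, eq_face hAB hW h0]

end FixedForest

end Biconing

/-! ### Rooted forests as a forest with a multiset of roots, and the final count -/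

section TwoEdgeRootedForests

variable {α : Type u} {β : Type v} {G : Graph α β} {A B : Set α} {hAB : V(G) = A ∪ B}

lemma rootNumber_eq {H : Graph (Vert α) (Edge α β)} {m : Multiset (Edge α β)}
    {C : Set (Vert α)} : rootNumber H m C = rootCount H (edgeRoots m) C := rfl

open Classical in
lemma isTwoEdgeRootedForest_iff {m : Multiset (Edge α β)} {K : Finset (Set (Vert α))}
    (hK : ∀ C, C ∈ K ↔ IsComponent ((reduced G A B hAB).restrict m.toFinset) C) :
    IsTwoEdgeRootedForest G A B hAB m ↔
      (m.toFinset : Set (Edge α β)) ⊆ E(reduced G A B hAB) ∧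
        IsForest ((reduced G A B hAB).restrict m.toFinset) ∧
          IsRooting ((reduced G A B hAB).restrict m.toFinset) A B K (edgeRoots m) := by
  have hH : supportGraph G A B hAB m = (reduced G A B hAB).restrict m.toFinset := by
    rw [supportGraph]
    congr 1
    ext e
    simp
  constructor
  · rintro ⟨h1, h2, h3, h4, h5⟩
    rw [hH] at h2 h3 h4 h5
    refine ⟨fun e he => h1 e (by simpa using he), h2, ?_, ?_, ?_⟩
    · intro C hC
      rw [← rootNumber_eq]
      by_contra hlt
      have := h4 C ((hK C).1 hC) (by omega)
      omega
    · intro C hC h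
      -- The parity clause unfolds to `HasOddRoots`, with `rootsIn` as the filtered multiset of
      -- roots.
      exact h5 C ((hK C).1 hC) h
    · intro C hC C' hC' h h'
      exact h3 C C' ((hK C).1 hC) ((hK C').1 hC') h h'
  · rintro ⟨h1, h2, h3⟩
    constructor
    · exact fun e he => h1 (by simpa using he)
    · rw [hH]
      exact h2
    · rw [hH]
      intro C C' hC hC' h h'
      exact h3.eq_of_eq_two C ((hK C).2 hC) C' ((hK C').2 hC') h h'
    · rw [hH]
      intro C hC h
      have := h3.le_two C ((hK C).2 hC)
      rw [← rootNumber_eq] at this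
      omega
    · rw [hH]
      intro C hC h
      exact h3.prop_of_eq_two C ((hK C).2 hC) h

open Classical in
lemma val_toFinset_add_edgeRoots (m : Multiset (Edge α β)) :
    m.toFinset.val + edgeRoots m = m :=
  add_tsub_cancel_of_le (Multiset.dedup_le m)

open Classical in
lemma toFinset_val_add {F : Finset (Edge α β)} {Q : Multiset (Edge α β)}
    (hQ : Q ≤ 2 • F.val) : (F.val + Q).toFinset = F := by
  ext e
  rw [Multiset.mem_toFinset, Multiset.mem_add]
  refine ⟨fun h => h.elim id fun h => ?_, Or.inl⟩
  simpa using Multiset.mem_of_le hQ h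

open Classical in
lemma edgeRoots_val_add {F : Finset (Edge α β)} {Q : Multiset (Edge α β)}
    (hQ : Q ≤ 2 • F.val) : edgeRoots (F.val + Q) = Q := by
  have h : (F.val + Q).dedup = F.val := congrArg Finset.val (toFinset_val_add hQ)
  rw [edgeRoots, h, add_tsub_cancel_left]

open Classical in
-- A component has at most two roots, so no edge carries more than two. Hence summing over
-- submultisets of `2 • F.val` misses no rooting.
lemma IsRooting.le {H : Graph (Vert α) (Edge α β)} {K : Finset (Set (Vert α))}
    {Q : Multiset (Edge α β)} {F : Finset (Edge α β)} (hK : ∀ C, C ∈ K ↔ IsComponent H C)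
    (hE : E(H) = F) (h : IsRooting H A B K Q) (hQ : ∀ e ∈ Q, e ∈ F) : Q ≤ 2 • F.val := by
  rw [Multiset.le_iff_count]
  intro e
  by_cases he : e ∈ Q
  · obtain ⟨C, ⟨hC, heC⟩, -⟩ := existsUnique_component_of_mem_edgeSet hK (e := e)
      (by rw [hE]; exact hQ e he)
    rw [Multiset.count_nsmul, Multiset.count_eq_one_of_mem F.nodup (hQ e he)]
    have h1 := h.le_two C hC
    have h2 := Multiset.count_le_card e (Q.filter (fun e => e ∈ edgesIn H C))
    rw [Multiset.count_filter_of_pos heC] at h2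
    unfold rootCount at h1
    omega
  · rw [Multiset.count_eq_zero_of_notMem he]
    exact Nat.zero_le _

lemma vertexSet_reduced_restrict {W : Finset α} (hW : (W : Set α) = V(G))
    (F : Set (Edge α β)) : V((reduced G A B hAB).restrict F) = rooted W := by
  rw [Graph.vertexSet_restrict, vertexSet_reduced, hW, rooted]

lemma edgeSet_reduced_restrict {F : Set (Edge α β)} (hF : F ⊆ E(reduced G A B hAB)) :
    E((reduced G A B hAB).restrict F) = F := by
  rw [Graph.edgeSet_restrict]
  exact Set.inter_eq_right.2 hF

/-- The root counts sum to the number of roots plus one, and to at most the number of components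
plus one; so the degree is at most the number of edges plus components of the forest. The bound
gives finiteness and keeps later subtractions in `ℕ` from truncating. -/
lemma IsTwoEdgeRootedForest.card_le {W : Finset α} (hW : (W : Set α) = V(G))
    {m : Multiset (Edge α β)} (hm : IsTwoEdgeRootedForest G A B hAB m) : m.card ≤ W.card + 1 := by
  classical
  have hV := vertexSet_reduced_restrict (hAB := hAB) hW (m.toFinset : Set (Edge α β))
  have hK : ∀ C, C ∈ components _ W hV ↔ IsComponent _ C := fun C => mem_components
  obtain ⟨h1, h2, h3⟩ := (isTwoEdgeRootedForest_iff hK).1 hm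
  have hE := edgeSet_reduced_restrict h1
  have hc := card_components_add_card h2 hK hV hE
  have hs := IsAdmissible.sum_le h3
  have hsub : ∀ e ∈ edgeRoots m, e ∈ m.toFinset := fun e he =>
    Multiset.mem_toFinset.2 (Multiset.mem_of_le tsub_le_self he)
  rw [sum_rootCount hK hV hE hsub] at hs
  have := congrArg Multiset.card (val_toFinset_add_edgeRoots m)
  rw [Multiset.card_add, Finset.card_val] at this
  omega

lemma finite_isTwoEdgeRootedForest (hV : V(G).Finite) (hE : E(G).Finite) :
    {m | IsTwoEdgeRootedForest G A B hAB m}.Finite := by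
  classical
  have hW : (hV.toFinset : Set α) = V(G) := hV.coe_toFinset
  have hfin := finite_edgeSet_biconing (hAB := hAB) hV hE
  refine (Finset.Iic ((hV.toFinset.card + 1) • hfin.toFinset.val)).finite_toSet.subset ?_
  intro m hm
  rw [Finset.coe_Iic, Set.mem_Iic, Multiset.le_iff_count]
  intro e
  by_cases he : e ∈ m
  · have he' : e ∈ hfin.toFinset := by
      rw [Set.Finite.mem_toFinset]
      exact (mem_edgeSet_reduced.1 (hm.subset e he)).1
    rw [Multiset.count_nsmul, Multiset.count_eq_one_of_mem (Finset.nodup _) he']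
    simpa using (Multiset.count_le_card e m).trans (hm.card_le hW)
  · rw [Multiset.count_eq_zero_of_notMem he]
    exact Nat.zero_le _

open Classical in
/-- The partially 2-edge-rooted forests with a fixed underlying forest `F`. -/
lemma sum_rootings_extending {M : Type*} [AddCommMonoid M]
    {K : Finset (Set (Vert α))} {F : Finset (Edge α β)}
    (hfin : {m | IsTwoEdgeRootedForest G A B hAB m}.Finite)
    (hF : (F : Set (Edge α β)) ⊆ E(reduced G A B hAB))
    (hf : IsForest ((reduced G A B hAB).restrict F))
    (hK : ∀ C, C ∈ K ↔ IsComponent ((reduced G A B hAB).restrict F) C) (g : ℕ → M) :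
    ∑ m ∈ hfin.toFinset.filter (fun m => m.toFinset = F), g m.card =
      ∑ Q ∈ Finset.Iic (2 • F.val),
        if IsRooting ((reduced G A B hAB).restrict F) A B K Q then g (F.card + Q.card) else 0 := by
  rw [← Finset.sum_filter]
  refine Finset.sum_bij' (fun m _ => edgeRoots m) (fun Q _ => F.val + Q) ?_ ?_ ?_ ?_ ?_
  all_goals simp only [Finset.mem_filter, Finset.mem_Iic, Set.Finite.mem_toFinset, and_imp]
  · rintro m hm rfl
    have h3 := ((isTwoEdgeRootedForest_iff hK).1 hm).2.2
    exact ⟨h3.le hK (edgeSet_reduced_restrict hF) fun e he =>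
      Multiset.mem_toFinset.2 (Multiset.mem_of_le tsub_le_self he), h3⟩
  · intro Q hQ h
    have h1 := toFinset_val_add hQ
    have h2 := edgeRoots_val_add hQ
    refine ⟨?_, h1⟩
    change IsTwoEdgeRootedForest G A B hAB _
    rw [isTwoEdgeRootedForest_iff (K := K) (by rw [h1]; exact hK), h1, h2]
    exact ⟨hF, hf, h⟩
  · rintro m hm rfl
    exact val_toFinset_add_edgeRoots m
  · intro Q hQ h
    exact edgeRoots_val_add hQ
  · rintro m hm rfl
    have := congrArg Multiset.card (val_toFinset_add_edgeRoots m)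
    rw [Multiset.card_add, Finset.card_val] at this
    rw [this]

/-- The same count, with marked vertices in place of roots, bounds the rank from above. -/
lemma card_le_of_mem_graphicComplex {W : Finset α} (hW : (W : Set α) = V(G))
    {I : Finset (Edge α β)} (hI : I ∈ graphicComplex (biconing G A B hAB)) :
    I.card ≤ W.card + 1 := by
  classical
  have hF := filter_subset_reduced hI.1
  have hf := isForest_filter hI
  set F := I.filter (fun e => e ∉ (baseTree A B : Set (Edge α β))) with hFdef
  set S := W.filter (fun a => treeEdge A a ∈ I) with hSdef
  have hV := vertexSet_reduced_restrict (hAB := hAB) hW (F : Set (Edge α β))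
  have hK : ∀ C, C ∈ components _ W hV ↔ IsComponent _ C := fun C => mem_components
  have hc := card_components_add_card hf hK hV (edgeSet_reduced_restrict hF)
  have hSW : S ⊆ W := Finset.filter_subset _ _
  have hs := sum_markCount hK hV (Finset.val_le_iff.2 hSW)
  have hcard := card_face hAB hF (S := S) (hW ▸ Finset.coe_subset.2 hSW)
  rw [Finset.card_val] at hs
  by_cases h0 : Edge.cone ∈ I
  · have heq : insert .cone (face A F S) = I := eq_insert_cone_face hAB hW h0
    rw [← heq, insert_cone_face_mem_graphicComplex_iff hW hF hSW hf hK] at hI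
    have := sum_le_card_of_le_one hI
    rw [← heq, Finset.card_insert_of_notMem (cone_notMem_face hF)]
    omega
  · have heq : face A F S = I := eq_face hAB hW h0
    rw [← heq, face_mem_graphicComplex_iff hW hF hSW hf hK] at hI
    have := hI.sum_le
    rw [← heq]
    omega

lemma faceRank_biconing {W : Finset α} (hW : (W : Set α) = V(G)) :
    faceRank (graphicComplex (biconing G A B hAB)) = W.card + 1 := by
  classical
  have hnil : ∀ x y (p : Walk ((reduced G A B hAB).restrict (∅ : Set (Edge α β))) x y), x = y ∧
      p.edges = [] := by
    intro x y p
    cases p with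
    | nil => simp
    | cons e h p => exact absurd h.1 (Set.notMem_empty e)
  -- The base tree `T₀` attains the bound: over the empty forest every component is a single vertex.
  have hmem : insert .cone (face A ∅ W) ∈ graphicComplex (biconing G A B hAB) := by
    refine ⟨?_, ?_⟩
    · rw [Finset.coe_insert]
      exact Set.insert_subset isLink_cone.edge_mem (face_subset_edgeSet (by simp) hW.le)
    · rw [Finset.coe_insert, coe_face, isForest_biconing_insert_cone_iff (by simp) hW.le
        W.finite_toSet]
      rw [Finset.coe_empty]
      exact ⟨fun x p hp => hp.1 (hnil x x p).2, fun x _ y _ ⟨p⟩ => (hnil x y p).1⟩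
  have hcard : (insert Edge.cone (face A (∅ : Finset (Edge α β)) W)).card = W.card + 1 := by
    rw [Finset.card_insert_of_notMem (cone_notMem_face (hAB := hAB) (by simp)),
      card_face hAB (by simp) hW.le]
    simp
  have hbdd : ∀ n ∈ Finset.card '' graphicComplex (biconing G A B hAB), n ≤ W.card + 1 := by
    rintro n ⟨I, hI, rfl⟩
    exact card_le_of_mem_graphicComplex hW hI
  refine le_antisymm (csSup_le ⟨_, _, hmem, rfl⟩ hbdd) ?_
  exact le_csSup ⟨_, hbdd⟩ ⟨_, hmem, hcard⟩

open Classical in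
/-- The `h`-polynomial of a biconed graph as a generating function of partially 2-edge-rooted
forests. -/
lemma hPoly_biconing (hV : V(G).Finite) (hE : E(G).Finite)
    (hfin : {m | IsTwoEdgeRootedForest G A B hAB m}.Finite) :
    hPoly (graphicComplex (biconing G A B hAB)) =
      ∑ m ∈ hfin.toFinset, (Polynomial.X : Polynomial ℤ) ^
        (faceRank (graphicComplex (biconing G A B hAB)) - m.card) := by
  have hW : (hV.toFinset : Set α) = V(G) := hV.coe_toFinset
  have hEb := finite_edgeSet_biconing (hAB := hAB) hV hE
  have hΔ := finite_graphicComplex (hAB := hAB) hV hE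
  rw [hPoly_eq_sum hΔ]
  let forests : Finset (Finset (Edge α β)) := hEb.toFinset.powerset.filter fun F =>
    (F : Set (Edge α β)) ⊆ E(reduced G A B hAB) ∧ IsForest ((reduced G A B hAB).restrict F)
  have hforests : ∀ F : Finset (Edge α β), (F : Set (Edge α β)) ⊆ E(reduced G A B hAB) →
      IsForest ((reduced G A B hAB).restrict F) → F ∈ forests := by
    intro F hF hf
    refine Finset.mem_filter.2 ⟨Finset.mem_powerset.2 fun e he => ?_, hF, hf⟩
    rw [Set.Finite.mem_toFinset]
    exact (mem_edgeSet_reduced.1 (hF he)).1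
  -- Both sums are grouped over the same finite set of forests of the reduced graph.
  rw [← Finset.sum_fiberwise_of_maps_to (t := forests)
      (g := fun I => I.filter (fun e => e ∉ (baseTree A B : Set (Edge α β)))),
    ← Finset.sum_fiberwise_of_maps_to (s := hfin.toFinset) (t := forests)
      (g := fun m => m.toFinset)]
  · refine Finset.sum_congr rfl fun F hF => ?_
    obtain ⟨-, hF, hf⟩ := Finset.mem_filter.1 hF
    have hV' := vertexSet_reduced_restrict (hAB := hAB) hW (F : Set (Edge α β))
    have hK : ∀ C, C ∈ components _ hV.toFinset hV' ↔ IsComponent _ C := fun C => mem_components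
    rw [sum_faces_extending hW hΔ hF hf hK fun n => (Polynomial.X - 1 : Polynomial ℤ) ^
        (faceRank (graphicComplex (biconing G A B hAB)) - n),
      sum_rootings_extending hfin hF hf hK fun n => (Polynomial.X : Polynomial ℤ) ^
        (faceRank (graphicComplex (biconing G A B hAB)) - n), faceRank_biconing hW]
    exact sum_faces_eq_sum_rootings _ (isColoured_reduced hAB _) hf hK hV'
      (edgeSet_reduced_restrict hF)
  · intro m hm
    have hm : IsTwoEdgeRootedForest G A B hAB m := hfin.mem_toFinset.1 hm
    have hV' := vertexSet_reduced_restrict (hAB := hAB) hW (m.toFinset : Set (Edge α β))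
    have h := (isTwoEdgeRootedForest_iff (K := components _ hV.toFinset hV')
      fun C => mem_components).1 hm
    exact hforests _ h.1 h.2.1
  · intro I hI
    have hI := hΔ.mem_toFinset.1 hI
    exact hforests _ (filter_subset_reduced hI.1) (isForest_filter hI)

end TwoEdgeRootedForests

end BiconedGraph

open BiconedGraph in
theorem theorem1 {α : Type*} {β : Type*} (G : Graph α β) (A B : Set α)
    (hV : V(G).Finite) (hE : E(G).Finite) (hAB : V(G) = A ∪ B)
    (i : Fin (faceRank (graphicComplex (biconing G A B hAB)) + 1)) :
    hVec (graphicComplex (biconing G A B hAB)) i =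
      ({m : Multiset (Edge α β) |
        IsTwoEdgeRootedForest G A B hAB m ∧ m.card = (i : ℕ)}.ncard : ℤ) := by
  classical
  have hfin := finite_isTwoEdgeRootedForest (hAB := hAB) hV hE
  have hW : (hV.toFinset : Set α) = V(G) := hV.coe_toFinset
  rw [hVec, hPoly_biconing hV hE hfin, Polynomial.finsetSum_coeff]
  simp only [Polynomial.coeff_X_pow]
  rw [Finset.sum_boole]
  congr 1
  rw [← Set.ncard_coe_finset]
  congr 1
  ext m
  simp only [Finset.coe_filter, Set.Finite.mem_toFinset, Set.mem_ofPred_eq]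
  -- Equality of the truncated exponents gives equality of degrees because neither `m.card` nor `i`
  -- exceeds the rank.
  refine and_congr_right fun hm => ?_
  have h1 := hm.card_le hW
  have h2 := faceRank_biconing (hAB := hAB) hW
  have h3 := i.is_lt
  omega
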